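/- Let $R$ be a real closed field and $K=R(i)$, $i^2=-1$, and let $\operatorname{val}\colon K\to\mathbb{R}\cup\{\infty\}$ be a (possibly trivial) valuation that is compatible with the order of $R$, i.e. $\operatorname{val}(b)\le\operatorname{val}(a)$ whenever $0\le a\le b$ in $R$. (For instance, $R=\mathbb{R}\{\!\{t\}\!\}$ and $K=\mathbb{C}\{\!\{t\}\!\}$ are the fields of real and complex Puiseux series.) Let $\mathfrak m$ be the maximal ideal of the valuation ring of $K$, and for every $\gamma$ in the value group $\operatorname{val}(K^*)$ let $t^\gamma\in K$ denote a chosen element of valuation $\gamma$. A polynomial $f\in K[x_1,\dots,x_n]$ is *stable* if $f(z)\neq 0$ for every $z=a+ib\in K^n$ with $a,b\in R^n$ and $b_1,\dots,b_n>0$. For $f=\sum_u c_u x^u\ne 0$ and $w\in\mathbb{R}^n$, the *$t$-initial form* $\operatorname{t-in}_w(f)$ is the sum of the terms $\overline{t^{-\operatorname{val}(c_u)}c_u}\,x^u$ over those $u\in\operatorname{supp}(f)=\{u: c_u\neq0\}$ that minimize $\operatorname{val}(c_u)+\langle w,u\rangle$ on $\operatorname{supp}(f)$, the bar being reduction modulo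 $\mathfrak m$ and $t^{-\gamma}:=(t^{\gamma})^{-1}$; it is a polynomial over the residue field. A bounded set $S\subset\mathbb{Z}^n$ is *M-convex* if $S=P\cap\mathbb{Z}^n$ for a nonempty lattice polytope $P\subset\mathbb R^n$ each of whose edges is parallel to $e_i-e_j$ for some $i,j$. For finite $S\subset\mathbb{Z}^n$, a function $\varphi\colon S\to\mathbb{R}$ is *M-convex* if for every $w\in\mathbb{R}^n$ the set of minimizers of $x\mapsto\varphi(x)+\langle w,x\rangle$ on $S$ is an M-convex set. **Theorem.** Let $f=\sum_u c_u x^u\in K[x_1,\dots,x_n]$ be homogeneous and stable. Then $u\mapsto\operatorname{val}(c_u)$ is an M-convex function on $\operatorname{supp}(f)$. Equivalently, for every $w\in\mathbb{R}^n$ (and every choice of the elements $t^\gamma$) the support of $\operatorname{t-in}_w(f)$ is an M-convex set. -/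

import Mathlib

noncomputable section

namespace MConvexStable

/-! ### M-convexity -/

/-- The inclusion `ℤⁿ ⊆ ℝⁿ`. -/
def toReal {n : ℕ} (x : Fin n → ℤ) : Fin n → ℝ := fun k => (x k : ℝ)

/-- `P ⊆ ℝⁿ` is an integral M-convex polyhedron (generalized permutohedron): the convex hull of
a nonempty finite set of lattice points, each of whose edges (one-dimensional faces) is parallel
to `e_i - e_j` for some `i`, `j`. -/
def IsIntegralMConvexPolytope {n : ℕ} (P : Set (Fin n → ℝ)) : Prop :=
  (∃ T : Finset (Fin n → ℤ), T.Nonempty ∧ P = convexHull ℝ (toReal '' (T : Set (Fin n → ℤ)))) ∧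
  ∀ a b : Fin n → ℝ, a ≠ b → IsExposed ℝ P (segment ℝ a b) →
    ∃ (i j : Fin n) (c : ℝ), b - a = c • (Pi.single i (1 : ℝ) - Pi.single j (1 : ℝ))

/-- `S ⊆ ℤⁿ` is an M-convex set: `S = P ∩ ℤⁿ` for an integral M-convex polyhedron `P`.
(Only bounded sets are needed.) -/
def IsMConvexSet {n : ℕ} (S : Set (Fin n → ℤ)) : Prop :=
  ∃ P : Set (Fin n → ℝ), IsIntegralMConvexPolytope P ∧ S = {x | toReal x ∈ P}

/-- The function `φ : S → ℝ` is M-convex: for every `w ∈ (ℝⁿ)*` the set of minimizers of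
`x ↦ φ x + ⟨w, x⟩` on `S` is an M-convex set. (The values of `φ` outside `S` play no role.) -/
def IsMConvexFun {n : ℕ} (S : Set (Fin n → ℤ)) (φ : (Fin n → ℤ) → ℝ) : Prop :=
  ∀ w : Fin n → ℝ,
    IsMConvexSet {x | x ∈ S ∧ ∀ y ∈ S, φ x + ∑ k, w k * (x k : ℝ) ≤ φ y + ∑ k, w k * (y k : ℝ)}

/-- The support of a polynomial as a set of exponent vectors in `ℤⁿ`. -/
def latticeSupport {n : ℕ} {A : Type*} [CommSemiring A] (f : MvPolynomial (Fin n) A) :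
    Set (Fin n → ℤ) :=
  {x | ∃ u ∈ f.support, x = fun k => (u k : ℤ)}

/-- The coefficient of `f` at an exponent vector `x ∈ ℤⁿ`, used for `x ∈ latticeSupport f`. -/
def latticeCoeff {n : ℕ} {A : Type*} [CommSemiring A] (f : MvPolynomial (Fin n) A)
    (x : Fin n → ℤ) : A :=
  f.coeff (Finsupp.equivFunOnFinite.symm fun k => (x k).toNat)

/-! ### Stability -/

/-- Let `K = R(i)` with `R` an ordered field and `i² = -1`. The polynomial `f` over `K` is stable
if `f(z) ≠ 0` for every `z = a + i b ∈ Kⁿ` (`a, b ∈ Rⁿ`) all of whose coordinates have positive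
imaginary part. -/
def IsStable (R : Type*) {K : Type*} [Field R] [LinearOrder R] [Field K] [Algebra R K] (i : K)
    {n : ℕ} (f : MvPolynomial (Fin n) K) : Prop :=
  ∀ a b : Fin n → R, (∀ k, 0 < b k) →
    MvPolynomial.eval (fun k => algebraMap R K (a k) + i * algebraMap R K (b k)) f ≠ 0

/-! ### Valuations and initial forms -/

section Valued

variable {K : Type*} [Field K]

/-- The valuation of a nonzero element as a real number. -/
def val (v : AddValuation K (WithTop ℝ)) (c : K) : ℝ := (v c).untopD 0

theorem coe_val (v : AddValuation K (WithTop ℝ)) {c : K} (hc : c ≠ 0) :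
    ((val v c : ℝ) : WithTop ℝ) = v c := by
  have h : v c ≠ ⊤ := (AddValuation.ne_top_iff v).2 hc
  obtain ⟨r, hr⟩ := WithTop.ne_top_iff_exists.1 h
  rw [val, ← hr, WithTop.untopD_coe]

/-- The valuation ring `{x | 0 ≤ v x}`. -/
abbrev valRing (v : AddValuation K (WithTop ℝ)) : ValuationSubring K :=
  (AddValuation.toValuation v).valuationSubring

theorem mem_valRing_iff (v : AddValuation K (WithTop ℝ)) (x : K) : x ∈ valRing v ↔ 0 ≤ v x := by
  rw [Valuation.mem_valuationSubring_iff]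
  rfl

/-- The residue field, i.e. the valuation ring modulo its maximal ideal. -/
abbrev ResidueField (v : AddValuation K (WithTop ℝ)) : Type _ :=
  IsLocalRing.ResidueField (valRing v)

open Classical in
/-- Reduction of an element of the valuation ring modulo the maximal ideal; it is only applied to
elements of valuation `0`. -/
def reduce (v : AddValuation K (WithTop ℝ)) (x : K) : ResidueField v :=
  if h : x ∈ valRing v then IsLocalRing.residue (valRing v) ⟨x, h⟩ else 0

/-- `t` picks, for each value `γ` of the valuation, an element `t γ` of valuation `γ`
(which plays the role of the power `t^γ` in a field of Puiseux series). -/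
def IsPowerChoice (v : AddValuation K (WithTop ℝ)) (t : ℝ → K) : Prop :=
  ∀ c : K, c ≠ 0 → v (t (val v c)) = v c

/-- The weight `val(c_u) + ⟨w, u⟩` of the exponent vector `u` of `f = ∑ c_u x^u`, i.e. the
valuation of the coefficient of `x^u` in `f(t^{w_1} x_1, …, t^{w_n} x_n)`. -/
def weight (v : AddValuation K (WithTop ℝ)) {n : ℕ} (w : Fin n → ℝ) (f : MvPolynomial (Fin n) K)
    (u : Fin n →₀ ℕ) : ℝ :=
  val v (f.coeff u) + ∑ k, w k * (u k : ℝ)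

open Classical in
/-- The `t`-initial form of `f = ∑ c_u x^u` with respect to `w`: the sum of
`(t^{-val(c_u)} c_u mod 𝔪) x^u` over those `u` in the support of `f` for which
`val(c_u) + ⟨w, u⟩` is minimal. This is the reduction modulo `𝔪` of
`t^μ f(t^{w_1} x_1, …, t^{w_n} x_n)`, where `-μ` is that minimum. -/
def tInit (v : AddValuation K (WithTop ℝ)) (t : ℝ → K) {n : ℕ} (w : Fin n → ℝ)
    (f : MvPolynomial (Fin n) K) : MvPolynomial (Fin n) (ResidueField v) :=
  ∑ u ∈ f.support with ∀ u' ∈ f.support, weight v w f u ≤ weight v w f u',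
    MvPolynomial.monomial u (reduce v (f.coeff u / t (val v (f.coeff u))))

end Valued

end MConvexStable

end

noncomputable section

set_option linter.unusedSectionVars false

namespace MConvexStable

/-! The core is a simultaneous exchange inequality. After division by the scalar f(1,…,1) the
coefficients a_u of f are nonnegative elements of R, and for x, y in the support with y_i < x_i
there are j with x_j < y_j and a natural number c such that a_x a_y ≤ c · a_p a_q, where p = x − e_i
+ e_j and q = y + e_i − e_j (`CartesianCoords.exchange`). A compatible valuation turns this into val
a_p + val a_q ≤ val a_x + val a_y, because val c ≥ 0; hence crude constants suffice throughout. A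
linear term w has the same sum over p, q as over x, y, so the minimizers of val + w are closed under
exchange, and a finite nonempty set with this property is M-convex (`Exchange.isMConvexSet`).

To prove the inequality, note that the operators D − x_k ∂_k and x_k ∂_k − D send a stable
polynomial to a stable one or to 0 when D bounds the degrees in x_k from above, respectively below.
Products of them multiply coefficients by weights that vanish outside a box of exponents
(`CartesianCoords.reduct_wt_box`). A box with one point shows that all coefficients have the phase
of f(1,…,1); the box spanned by x and y localizes the problem. There the variables are merged into
three groups, and the exchange inequality for ternary forms (`CartesianCoords.tcoeff_exchange`)
follows from a Newton type and a bilinear inequality. Merging produces sums over j; scaling the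
variables by arbitrary positive η, with a constant independent of η, extracts a single j that serves
both factors (`exists_le_mul_of_forall`).

Since R may be non-archimedean, limits are replaced by estimates uniform in ε > 0. Univariate
polynomials are factored over K, which is algebraically closed (`CartesianCoords.isAlgClosed`). -/

/-- Cartesian coordinates on a field `K = R(i)`, `i² = -1`, over an ordered field `R`. -/
structure CartesianCoords (R K : Type*) [Field R] [LinearOrder R] [Field K] [Algebra R K] where
  /-- the imaginary unit -/
  i : K
  /-- the real part -/
  re : K →ₗ[R] R
  /-- the imaginary part -/
  im : K →ₗ[R] R
  i_mul_i : i * i = -1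
  eta : ∀ z, algebraMap R K (re z) + i * algebraMap R K (im z) = z
  re_mk : ∀ a b, re (algebraMap R K a + i * algebraMap R K b) = a
  im_mk : ∀ a b, im (algebraMap R K a + i * algebraMap R K b) = b

/-! ### Existence and uniqueness of real and imaginary parts in `R(i)`. -/

section Construction

variable {R K : Type*} [Field R] [LinearOrder R] [IsStrictOrderedRing R] [Field K] [Algebra R K]

/-- If b ≠ b', then i would lie in R and −1 would be a square in an ordered field. -/
theorem cartesian_unique {i : K} (hi : i * i = -1) {a b a' b' : R}
    (h : algebraMap R K a + i * algebraMap R K b = algebraMap R K a' + i * algebraMap R K b') :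
    a = a' ∧ b = b' := by
  have hinj := (algebraMap R K).injective
  have hb : b = b' := by
    by_contra hne
    have h0 : b - b' ≠ 0 := sub_ne_zero.2 hne
    have h1 : i * algebraMap R K (b - b') = algebraMap R K (a' - a) := by
      simp only [map_sub]; linear_combination h
    have h2 : algebraMap R K (-((b - b') * (b - b'))) = algebraMap R K ((a' - a) * (a' - a)) := by
      rw [map_mul, ← h1, map_neg, map_mul]
      linear_combination -(algebraMap R K (b - b')) * (algebraMap R K (b - b')) * hi
    have h3 := hinj h2
    have := mul_self_pos.2 h0
    have := mul_self_nonneg (a' - a)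
    linarith
  subst hb
  exact ⟨hinj (by linear_combination h), rfl⟩

omit [LinearOrder R] [IsStrictOrderedRing R] in
theorem exists_cartesian {i : K} (hi : i * i = -1) (hK : IntermediateField.adjoin R {i} = ⊤)
    (z : K) : ∃ p : R × R, algebraMap R K p.1 + i * algebraMap R K p.2 = z := by
  have hint : IsIntegral R i :=
    ⟨Polynomial.X ^ 2 + 1, by monicity!, by simp [pow_two, hi]⟩
  have hz : z ∈ Algebra.adjoin R {i} := by
    have h := IntermediateField.adjoin_simple_toSubalgebra_of_isAlgebraic hint.isAlgebraic
    rw [← h, hK]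
    trivial
  induction hz using Algebra.adjoin_induction with
  | mem x hx =>
    rw [Set.mem_singleton_iff] at hx
    exact ⟨(0, 1), by simp [hx]⟩
  | algebraMap r => exact ⟨(r, 0), by simp⟩
  | add x y _ _ hx hy =>
    obtain ⟨p, rfl⟩ := hx
    obtain ⟨q, rfl⟩ := hy
    exact ⟨(p.1 + q.1, p.2 + q.2), by simp only [map_add]; ring⟩
  | mul x y _ _ hx hy =>
    obtain ⟨p, rfl⟩ := hx
    obtain ⟨q, rfl⟩ := hy
    refine ⟨(p.1 * q.1 - p.2 * q.2, p.1 * q.2 + p.2 * q.1), ?_⟩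
    simp only [map_add, map_sub, map_mul]
    linear_combination -(algebraMap R K p.2 * algebraMap R K q.2) * hi

/-- The coordinates of `K = R(i)`. -/
def CartesianCoords.ofAdjoin (i : K) (hi : i * i = -1)
    (hK : IntermediateField.adjoin R {i} = ⊤) : CartesianCoords R K where
  i := i
  re :=
    { toFun := fun z => (exists_cartesian hi hK z).choose.1
      map_add' := fun x y => (cartesian_unique hi (b := (exists_cartesian hi hK (x + y)).choose.2)
        (b' := (exists_cartesian hi hK x).choose.2 + (exists_cartesian hi hK y).choose.2) (by
          rw [(exists_cartesian hi hK (x + y)).choose_spec]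
          simp only [map_add]
          linear_combination -(exists_cartesian hi hK x).choose_spec
            - (exists_cartesian hi hK y).choose_spec)).1
      map_smul' := fun r x => (cartesian_unique hi (b := (exists_cartesian hi hK (r • x)).choose.2)
        (b' := r * (exists_cartesian hi hK x).choose.2) (by
          rw [(exists_cartesian hi hK (r • x)).choose_spec]
          simp only [smul_eq_mul, map_mul, Algebra.smul_def, RingHom.id_apply]
          linear_combination -algebraMap R K r * (exists_cartesian hi hK x).choose_spec)).1 }
  im :=
    { toFun := fun z => (exists_cartesian hi hK z).choose.2
      map_add' := fun x y => (cartesian_unique hi (a := (exists_cartesian hi hK (x + y)).choose.1)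
        (a' := (exists_cartesian hi hK x).choose.1 + (exists_cartesian hi hK y).choose.1) (by
          rw [(exists_cartesian hi hK (x + y)).choose_spec]
          simp only [map_add]
          linear_combination -(exists_cartesian hi hK x).choose_spec
            - (exists_cartesian hi hK y).choose_spec)).2
      map_smul' := fun r x => (cartesian_unique hi (a := (exists_cartesian hi hK (r • x)).choose.1)
        (a' := r * (exists_cartesian hi hK x).choose.1) (by
          rw [(exists_cartesian hi hK (r • x)).choose_spec]
          simp only [smul_eq_mul, map_mul, Algebra.smul_def, RingHom.id_apply]
          linear_combination -algebraMap R K r * (exists_cartesian hi hK x).choose_spec)).2 }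
  i_mul_i := hi
  eta z := (exists_cartesian hi hK z).choose_spec
  re_mk a b := (cartesian_unique hi (exists_cartesian hi hK
    (algebraMap R K a + i * algebraMap R K b)).choose_spec).1
  im_mk a b := (cartesian_unique hi (exists_cartesian hi hK
    (algebraMap R K a + i * algebraMap R K b)).choose_spec).2

end Construction

/-! ### Arithmetic of real and imaginary parts. -/

namespace CartesianCoords

variable {R K : Type*} [Field R] [LinearOrder R] [Field K] [Algebra R K]
  (S : CartesianCoords R K)

theorem ext_iff' {z w : K} : z = w ↔ S.re z = S.re w ∧ S.im z = S.im w :=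
  ⟨fun h => by simp [h], fun h => by rw [← S.eta z, h.1, h.2, S.eta]⟩

@[simp] theorem re_algebraMap (a : R) : S.re (algebraMap R K a) = a := by
  simpa using S.re_mk a 0

@[simp] theorem im_algebraMap (a : R) : S.im (algebraMap R K a) = 0 := by
  simpa using S.im_mk a 0

@[simp] theorem re_i : S.re S.i = 0 := by simpa using S.re_mk 0 1

@[simp] theorem im_i : S.im S.i = 1 := by simpa using S.im_mk 0 1

@[simp] theorem re_one : S.re 1 = 1 := by simpa using S.re_mk 1 0

@[simp] theorem im_one : S.im 1 = 0 := by simpa using S.im_mk 1 0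

theorem mul_eq (z w : K) : z * w = algebraMap R K (S.re z * S.re w - S.im z * S.im w) +
    S.i * algebraMap R K (S.re z * S.im w + S.im z * S.re w) := by
  conv_lhs => rw [← S.eta z, ← S.eta w]
  simp only [map_add, map_sub, map_mul]
  linear_combination (algebraMap R K (S.im z) * algebraMap R K (S.im w)) * S.i_mul_i

@[simp] theorem re_mul (z w : K) : S.re (z * w) = S.re z * S.re w - S.im z * S.im w := by
  rw [S.mul_eq, S.re_mk]

@[simp] theorem im_mul (z w : K) : S.im (z * w) = S.re z * S.im w + S.im z * S.re w := by
  rw [S.mul_eq, S.im_mk]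

/-- The squared modulus. -/
def normSq (z : K) : R := S.re z ^ 2 + S.im z ^ 2

variable [IsStrictOrderedRing R]

theorem normSq_nonneg (z : K) : 0 ≤ S.normSq z := by unfold normSq; positivity

theorem normSq_pos {z : K} (hz : z ≠ 0) : 0 < S.normSq z := by
  refine lt_of_le_of_ne (S.normSq_nonneg z) fun h => hz ?_
  unfold normSq at h
  have h1 : S.re z = 0 := by nlinarith [sq_nonneg (S.re z), sq_nonneg (S.im z)]
  have h2 : S.im z = 0 := by nlinarith [sq_nonneg (S.re z), sq_nonneg (S.im z)]
  rw [S.ext_iff', h1, h2]; simp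

theorem inv_eq (z : K) : z⁻¹ = algebraMap R K (S.re z / S.normSq z) +
    S.i * algebraMap R K (-S.im z / S.normSq z) := by
  rcases eq_or_ne z 0 with rfl | hz
  · simp
  · have h := (S.normSq_pos hz).ne'
    refine (eq_inv_of_mul_eq_one_right ?_).symm
    rw [S.ext_iff']
    simp only [S.re_mul, S.im_mul, S.re_mk, S.im_mk, re_one, im_one]
    constructor
    · field_simp; unfold normSq; ring
    · field_simp; ring

theorem re_inv (z : K) : S.re z⁻¹ = S.re z / S.normSq z := by
  conv_lhs => rw [S.inv_eq z, S.re_mk]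

theorem im_inv (z : K) : S.im z⁻¹ = -S.im z / S.normSq z := by
  conv_lhs => rw [S.inv_eq z, S.im_mk]

end CartesianCoords

/-! ### `R(i)` is algebraically closed -/

section AlgClosed

variable {R K : Type*} [Field R] [LinearOrder R] [IsStrictOrderedRing R] [IsRealClosed R]
  [Field K] [Algebra R K] (S : CartesianCoords R K)

-- For z = a + ib and r = |z|, take x² = (r + a)/2 and y² = (r − a)/2; then (2xy)² = b², and the
-- sign of y is adjusted so that 2xy = b.
include S in
theorem CartesianCoords.exists_sqrt (z : K) : ∃ s, z = s * s := by
  obtain ⟨r, hr⟩ := IsRealClosed.exists_eq_pow_of_nonneg (S.normSq_nonneg z) two_ne_zero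
  wlog hr0 : 0 ≤ r generalizing r
  · exact this (-r) (by rw [hr]; ring) (by linarith)
  set a := S.re z
  set b := S.im z
  have hab : a ^ 2 + b ^ 2 = r ^ 2 := hr
  have h1 : -r ≤ a ∧ a ≤ r := abs_le.1 (abs_le_of_sq_le_sq (by nlinarith [sq_nonneg b]) hr0)
  obtain ⟨x, hx⟩ := IsRealClosed.exists_eq_pow_of_nonneg
    (show 0 ≤ (r + a) / 2 by linarith) two_ne_zero
  obtain ⟨y, hy⟩ := IsRealClosed.exists_eq_pow_of_nonneg
    (show 0 ≤ (r - a) / 2 by linarith) two_ne_zero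
  have hxy : (2 * x * y) ^ 2 = b ^ 2 := by
    rw [mul_pow, mul_pow, ← hx, ← hy]; linear_combination -hab
  rcases sq_eq_sq_iff_eq_or_eq_neg.1 hxy with h | h
  · refine ⟨algebraMap R K x + S.i * algebraMap R K y, ?_⟩
    rw [S.ext_iff']
    simp only [S.re_mul, S.im_mul, S.re_mk, S.im_mk]
    constructor
    · change a = _; linear_combination hx - hy
    · change b = _; linear_combination -h
  · refine ⟨algebraMap R K x + S.i * algebraMap R K (-y), ?_⟩
    rw [S.ext_iff']
    simp only [S.re_mul, S.im_mul, S.re_mk, S.im_mk]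
    constructor
    · change a = _; linear_combination hx - hy
    · change b = _; linear_combination h

/-- An element outside F would have a quadratic minimal polynomial, which has a root in F by the
quadratic formula. -/
theorem finrank_ne_two_of_sqrt {F E : Type*} [Field F] [Field E] [Algebra F E]
    [NeZero (2 : F)] (h : ∀ z : F, ∃ s, z = s * s) : Module.finrank F E ≠ 2 := by
  intro h2
  have : FiniteDimensional F E := Module.finite_of_finrank_pos (by omega)
  have hne : ∃ x : E, x ∉ (⊥ : Subalgebra F E) := by
    by_contra! hx
    have : (⊥ : Subalgebra F E) = ⊤ := by ext; simp [hx]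
    have := Subalgebra.bot_eq_top_iff_finrank_eq_one.1 this
    omega
  obtain ⟨x, hx⟩ := hne
  have hint : IsIntegral F x := .of_finite F x
  have hdeg : (minpoly F x).natDegree ≤ 2 := h2 ▸ minpoly.natDegree_le x
  have hirr := minpoly.irreducible hint
  have hmon := minpoly.monic hint
  have h1 : (minpoly F x).natDegree ≠ 1 := fun h => hx (by
    have := (minpoly.natDegree_eq_one_iff (A := F) (x := x)).1 h
    rwa [Algebra.mem_bot])
  have h0 := minpoly.natDegree_pos hint
  have hd : (minpoly F x).natDegree = 2 := by omega
  set p := minpoly F x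
  have hp : p = Polynomial.X ^ 2 + Polynomial.C (p.coeff 1) * Polynomial.X
      + Polynomial.C (p.coeff 0) := by
    have h := p.as_sum_range_C_mul_X_pow
    rw [hd] at h
    have hc : p.coeff 2 = 1 := by rw [← hd]; exact hmon
    simp only [Finset.sum_range_succ, Finset.sum_range_zero, hc] at h
    conv_lhs => rw [h]
    simp; ring
  obtain ⟨t, ht⟩ := exists_quadratic_eq_zero (a := (1 : F)) (b := p.coeff 1) (c := p.coeff 0)
    one_ne_zero (h _)
  have hroot : p.IsRoot t := by
    rw [Polynomial.IsRoot, hp]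
    simp only [Polynomial.eval_add, Polynomial.eval_mul, Polynomial.eval_pow, Polynomial.eval_X,
      Polynomial.eval_C]
    linear_combination ht
  have := Polynomial.degree_eq_one_of_irreducible_of_root hirr hroot
  rw [Polynomial.degree_eq_natDegree hmon.ne_zero, hd] at this
  norm_cast at this

theorem finrank_eq_one_of_odd {E : Type*} [Field E] [Algebra R E] [FiniteDimensional R E]
    (h : Odd (Module.finrank R E)) : Module.finrank R E = 1 := by
  obtain ⟨α, hα⟩ := Field.exists_primitive_element R E
  have hint : IsIntegral R α := .of_finite R α
  have hd : (minpoly R α).natDegree = Module.finrank R E :=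
    (Field.primitive_element_iff_minpoly_natDegree_eq R α).1 hα
  obtain ⟨x, hx⟩ := IsRealClosed.exists_isRoot_of_odd_natDegree (hd ▸ h)
  have := Polynomial.degree_eq_one_of_irreducible_of_root (minpoly.irreducible hint) hx
  rw [← hd]
  exact Polynomial.natDegree_eq_of_degree_eq_some this

omit [IsStrictOrderedRing R] [IsRealClosed R] in
include S in
theorem CartesianCoords.finiteDimensional : FiniteDimensional R K :=
  Module.Finite.of_surjective
    (LinearMap.coprod (Algebra.linearMap R K) ((LinearMap.mulLeft R S.i).comp
      (Algebra.linearMap R K))) fun z => ⟨(S.re z, S.im z), by simpa using S.eta z⟩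

-- The fixed field of a Sylow 2-subgroup has odd degree over R, so it has degree 1 and [N : R] is a
-- power of 2. If [N : K] > 1, a subgroup of index 2 in the Galois group over K would yield a
-- quadratic extension of K, although every element of K is a square.
include S in
theorem CartesianCoords.finrank_eq_one_of_isGalois {N : Type*} [Field N] [Algebra R N]
    [Algebra K N] [IsScalarTower R K N] [FiniteDimensional R N] [IsGalois R N] :
    Module.finrank K N = 1 := by
  have hKR := S.finiteDimensional
  have : FiniteDimensional K N := FiniteDimensional.right R K N
  have : IsGalois K N := IsGalois.tower_top_of_isGalois R K N
  have : Fact (Nat.Prime 2) := ⟨Nat.prime_two⟩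
  let P : Sylow 2 (N ≃ₐ[R] N) := default
  have hodd : Odd (Module.finrank R (IntermediateField.fixedField (P : Subgroup (N ≃ₐ[R] N)))) := by
    have h1 := P.not_dvd_index
    rw [← even_iff_two_dvd, Nat.not_even_iff_odd] at h1
    rw [IntermediateField.finrank_eq_fixingSubgroup_index,
      IntermediateField.fixingSubgroup_fixedField]
    exact h1
  have h1 := finrank_eq_one_of_odd hodd
  have hcard : ∃ k, Module.finrank R N = 2 ^ k := by
    obtain ⟨k, hk⟩ := IsPGroup.iff_card.1 P.isPGroup'
    refine ⟨k, ?_⟩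
    rw [← Module.finrank_mul_finrank R
      (IntermediateField.fixedField (P : Subgroup (N ≃ₐ[R] N))) N, h1, one_mul,
      IntermediateField.finrank_fixedField_eq_card, ← hk]
  obtain ⟨k, hk⟩ := hcard
  have hdvd : Module.finrank K N ∣ 2 ^ k := ⟨Module.finrank R K, by
    rw [← hk, ← Module.finrank_mul_finrank R K N, mul_comm]⟩
  obtain ⟨j, -, hj⟩ := (Nat.dvd_prime_pow Nat.prime_two).1 hdvd
  rcases j with _ | j
  · simpa using hj
  · exfalso
    have hG : Nat.card (N ≃ₐ[K] N) = 2 ^ (j + 1) := by rw [IsGalois.card_aut_eq_finrank, hj]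
    obtain ⟨H, hH⟩ := Sylow.exists_subgroup_card_pow_prime (G := N ≃ₐ[K] N) 2 (n := j)
      (by rw [hG]; exact pow_dvd_pow 2 (Nat.le_succ j))
    have h2 : Module.finrank K (IntermediateField.fixedField H) = 2 := by
      have h3 := Module.finrank_mul_finrank K (IntermediateField.fixedField H) N
      rw [IntermediateField.finrank_fixedField_eq_card, hH, hj, pow_succ, mul_comm] at h3
      exact mul_left_cancel₀ (by positivity) h3
    have : CharZero K := charZero_of_injective_algebraMap (algebraMap R K).injective
    exact finrank_ne_two_of_sqrt S.exists_sqrt h2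

-- A root adjoined to K lies in a normal closure over R, which has degree 1 over K by the Galois
-- case.
include S in
theorem CartesianCoords.isAlgClosed : IsAlgClosed K := by
  have hKR := S.finiteDimensional
  refine IsAlgClosed.of_exists_root _ fun p hmon hirr => ?_
  have : Fact (Irreducible p) := ⟨hirr⟩
  have hp0 := hirr.ne_zero
  let E := AdjoinRoot p
  have : IsScalarTower R K E := inferInstance
  have : FiniteDimensional K E := (AdjoinRoot.powerBasis hp0).finite
  have : FiniteDimensional R E := .trans R K E
  let A := AlgebraicClosure E
  let N := IntermediateField.normalClosure R E A
  let _ : Algebra K N := ((algebraMap E N).comp (algebraMap K E)).toAlgebra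
  have : IsScalarTower K E N := .of_algebraMap_eq fun _ => rfl
  have : IsScalarTower R K N := .of_algebraMap_eq fun x => by
    change algebraMap R N x = algebraMap E N (algebraMap R E x)
    exact IsScalarTower.algebraMap_apply R E N x
  have : IsGalois R N := by
    have : Normal R N := inferInstance
    exact ⟨⟩
  have h1 : Module.finrank K N = 1 := S.finrank_eq_one_of_isGalois
  have hb := (Subalgebra.bot_eq_top_iff_finrank_eq_one (F := K) (E := N)).2 h1
  obtain ⟨x, hx⟩ : ∃ x : K, algebraMap K N x = algebraMap E N (AdjoinRoot.root p) := by
    have : algebraMap E N (AdjoinRoot.root p) ∈ (⊥ : Subalgebra K N) := by rw [hb]; trivial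
    exact Algebra.mem_bot.1 this
  refine ⟨x, ?_⟩
  have h2 : algebraMap K E x = AdjoinRoot.root p := (algebraMap E N).injective (by
    rw [← hx]; exact (IsScalarTower.algebraMap_apply K E N x).symm)
  have h3 := AdjoinRoot.eval₂_root p
  rw [← h2] at h3
  apply (algebraMap K E).injective
  rw [map_zero, ← h3]
  exact (Polynomial.eval₂_at_apply (algebraMap K E) x).symm

end AlgClosed

open MvPolynomial

theorem exists_pos_le_forall {R ι : Type*} [Field R] [LinearOrder R] [IsStrictOrderedRing R]
    [Fintype ι] (a : ι → R) (ha : ∀ k, 0 < a k) : ∃ r, 0 < r ∧ ∀ k, r ≤ a k := by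
  have h0 : 0 ≤ ∑ k, (a k)⁻¹ := Finset.sum_nonneg fun k _ => (inv_pos.2 (ha k)).le
  refine ⟨(1 + ∑ k, (a k)⁻¹)⁻¹, by positivity, fun k => ?_⟩
  rw [inv_le_comm₀ (by positivity) (ha k)]
  have := Finset.single_le_sum (f := fun k => (a k)⁻¹) (fun k _ => (inv_pos.2 (ha k)).le)
    (Finset.mem_univ k)
  linarith

/-- Stands in for letting ε tend to 0 over a possibly non-archimedean field. -/
theorem eq_zero_of_forall_pos_le_mul {R : Type*} [Field R] [LinearOrder R]
    [IsStrictOrderedRing R] {x B : R} (hx : 0 ≤ x) (h : ∀ ε, 0 < ε → x ≤ ε * B) : x = 0 := by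
  by_contra hne
  have hx0 : 0 < x := lt_of_le_of_ne hx (Ne.symm hne)
  have h1 := h 1 one_pos
  have hB : 0 < B := by linarith
  have h2 := h (x / (2 * B)) (by positivity)
  have : x / (2 * B) * B = x / 2 := by field_simp
  linarith

/-! ### Multiplier operators on coefficients -/

section Multiplier

variable {R K ι : Type*} [Field R] [Field K] [Algebra R K]

/-- Multiply the coefficient of `x^u` by `ω u`. -/
def wt (ω : (ι →₀ ℕ) → R) (f : MvPolynomial ι K) : MvPolynomial ι K :=
  ∑ u ∈ f.support, monomial u (algebraMap R K (ω u) * coeff u f)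

@[simp] theorem coeff_wt (ω : (ι →₀ ℕ) → R) (f : MvPolynomial ι K) (u : ι →₀ ℕ) :
    coeff u (wt ω f) = algebraMap R K (ω u) * coeff u f := by
  classical
  simp only [wt, coeff_sum, coeff_monomial, Finset.sum_ite_eq']
  split_ifs with h
  · rfl
  · rw [notMem_support_iff.1 h, mul_zero]

theorem wt_wt (ω ω' : (ι →₀ ℕ) → R) (f : MvPolynomial ι K) :
    wt ω (wt ω' f) = wt (fun u => ω u * ω' u) f := by
  ext u; simp [mul_assoc]

theorem support_wt_subset (ω : (ι →₀ ℕ) → R) (f : MvPolynomial ι K) :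
    (wt ω f).support ⊆ f.support := fun u hu => by
  rw [mem_support_iff, coeff_wt] at hu
  exact mem_support_iff.2 (right_ne_zero_of_mul hu)

theorem isHomogeneous_wt (ω : (ι →₀ ℕ) → R) {f : MvPolynomial ι K} {d : ℕ}
    (hf : f.IsHomogeneous d) : (wt ω f).IsHomogeneous d := fun u hu => by
  rw [coeff_wt] at hu
  exact hf (right_ne_zero_of_mul hu)

theorem eval_wt [Fintype ι] (ω : (ι →₀ ℕ) → R) (f : MvPolynomial ι K) (z : ι → K) :
    eval z (wt ω f) =
      ∑ u ∈ f.support, algebraMap R K (ω u) * (coeff u f * ∏ k, z k ^ u k) := by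
  simp only [wt, map_sum, eval_monomial]
  refine Finset.sum_congr rfl fun u _ => ?_
  rw [mul_assoc, Finsupp.prod_fintype _ _ fun _ => pow_zero _]

open Classical in
/-- The univariate polynomial obtained from `f` by fixing all coordinates but the `k`-th. -/
def fiber [Fintype ι] (f : MvPolynomial ι K) (z : ι → K) (k : ι) : Polynomial K :=
  ∑ u ∈ f.support,
    Polynomial.C (coeff u f * ∏ l ∈ Finset.univ.erase k, z l ^ u l) * Polynomial.X ^ u k

open Classical in
theorem eval_fiber [Fintype ι] (f : MvPolynomial ι K) (z : ι → K) (k : ι) (t : K) :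
    (fiber f z k).eval t = eval (Function.update z k t) f := by
  rw [fiber, Polynomial.eval_finsetSum, eval_eq']
  refine Finset.sum_congr rfl fun u _ => ?_
  rw [← Finset.mul_prod_erase Finset.univ _ (Finset.mem_univ k)]
  have : ∏ l ∈ Finset.univ.erase k, Function.update z k t l ^ u l
      = ∏ l ∈ Finset.univ.erase k, z l ^ u l :=
    Finset.prod_congr rfl fun l hl => by
      rw [Function.update_of_ne (Finset.ne_of_mem_erase hl)]
  simp only [this, Function.update_self, Polynomial.eval_mul, Polynomial.eval_C,
    Polynomial.eval_pow, Polynomial.eval_X]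
  ring

theorem eval_fiber_self [Fintype ι] (f : MvPolynomial ι K) (z : ι → K) (k : ι) :
    (fiber f z k).eval (z k) = eval z f := by
  classical rw [eval_fiber, Function.update_eq_self]

/-- The weight κ − u_k is the operator κ − x_k ∂_k, which sees only the fiber in x_k; preservation
of stability thereby becomes a question about univariate polynomials. -/
theorem eval_wt_sub [Fintype ι] (f : MvPolynomial ι K) (z : ι → K) (k : ι) (κ : R) :
    eval z (wt (fun u => κ - (u k : R)) f) = algebraMap R K κ * (fiber f z k).eval (z k)
      - z k * (fiber f z k).derivative.eval (z k) := by
  classical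
  rw [eval_wt, fiber, Polynomial.derivative_sum, Polynomial.eval_finsetSum,
    Polynomial.eval_finsetSum, Finset.mul_sum, Finset.mul_sum, ← Finset.sum_sub_distrib]
  refine Finset.sum_congr rfl fun u _ => ?_
  rw [← Finset.mul_prod_erase Finset.univ _ (Finset.mem_univ k)]
  simp only [Polynomial.derivative_C_mul, Polynomial.derivative_X_pow, Polynomial.eval_mul,
    Polynomial.eval_C, Polynomial.eval_pow, Polynomial.eval_X, Polynomial.eval_natCast, map_sub,
    map_natCast]
  rcases h : u k with _ | m
  · simp
  · simp only [Nat.add_sub_cancel, pow_succ]; ring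

theorem natDegree_fiber_le [Fintype ι] (f : MvPolynomial ι K) (z : ι → K) (k : ι) {D : ℕ}
    (h : ∀ u ∈ f.support, u k ≤ D) : (fiber f z k).natDegree ≤ D :=
  Polynomial.natDegree_sum_le_of_forall_le _ _ fun u hu =>
    (Polynomial.natDegree_C_mul_X_pow_le _ _).trans (h u hu)

theorem X_pow_dvd_fiber [Fintype ι] (f : MvPolynomial ι K) (z : ι → K) (k : ι) {D : ℕ}
    (h : ∀ u ∈ f.support, D ≤ u k) : Polynomial.X ^ D ∣ fiber f z k :=
  Finset.dvd_sum fun u hu => (pow_dvd_pow _ (h u hu)).mul_left _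

end Multiplier

namespace CartesianCoords

variable {R K ι : Type*} [Field R] [LinearOrder R] [IsStrictOrderedRing R]
  [Field K] [Algebra R K] (S : CartesianCoords R K)

theorem im_sum_multiset (s : Multiset K) : S.im s.sum = (s.map S.im).sum :=
  map_multiset_sum S.im s

/-! ### Hurwitz' theorem -/

/-- The `ℓ¹`-norm. -/
def l1 (z : K) : R := |S.re z| + |S.im z|

theorem l1_nonneg (z : K) : 0 ≤ S.l1 z := by unfold l1; positivity

theorem l1_add_le (z w : K) : S.l1 (z + w) ≤ S.l1 z + S.l1 w := by
  have h1 := abs_add_le (S.re z) (S.re w)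
  have h2 := abs_add_le (S.im z) (S.im w)
  simp only [l1, map_add]; linarith

theorem l1_neg (z : K) : S.l1 (-z) = S.l1 z := by simp [l1]

theorem l1_mul_le (z w : K) : S.l1 (z * w) ≤ S.l1 z * S.l1 w := by
  have h1 := abs_sub (S.re z * S.re w) (S.im z * S.im w)
  have h2 := abs_add_le (S.re z * S.im w) (S.im z * S.re w)
  simp only [abs_mul] at h1 h2
  simp only [l1, S.re_mul, S.im_mul]; linarith

theorem l1_one : S.l1 1 = 1 := by simp [l1]

theorem l1_algebraMap (a : R) : S.l1 (algebraMap R K a) = |a| := by simp [l1]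

theorem eq_zero_of_l1 {z : K} (h : S.l1 z = 0) : z = 0 := by
  have h1 := abs_nonneg (S.re z)
  have h2 := abs_nonneg (S.im z)
  unfold l1 at h
  rw [S.ext_iff', map_zero, map_zero]
  exact ⟨abs_eq_zero.1 (by linarith), abs_eq_zero.1 (by linarith)⟩

theorem l1_inv_le {ρ : K} {r : R} (hr : 0 < r) (h : r ≤ |S.im ρ|) : S.l1 ρ⁻¹ ≤ 2 / r := by
  have hρ : ρ ≠ 0 := by rintro rfl; simp at h; linarith
  have hN := S.normSq_pos hρ
  rw [l1, S.re_inv, S.im_inv, abs_div, abs_div, abs_neg, abs_of_pos hN, ← add_div,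
    div_le_div_iff₀ hN hr]
  unfold normSq
  rw [← sq_abs (S.re ρ), ← sq_abs (S.im ρ)]
  nlinarith [abs_nonneg (S.re ρ), abs_nonneg (S.im ρ), sq_nonneg (|S.re ρ| - |S.im ρ|)]

theorem l1_coeff_prod_le {M : R} (hM : 0 ≤ M) (s : Multiset K) (hs : ∀ σ ∈ s, S.l1 σ ≤ M)
    (k : ℕ) : S.l1 ((s.map fun σ => 1 - Polynomial.C σ * Polynomial.X).prod.coeff k)
      ≤ (1 + M) ^ s.card := by
  induction s using Multiset.induction_on generalizing k with
  | empty =>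
    simp only [Multiset.map_zero, Multiset.prod_zero, Multiset.card_zero, pow_zero,
      Polynomial.coeff_one]
    split_ifs
    · exact S.l1_one.le
    · simp [l1]
  | cons σ s ih =>
    have ih' := ih fun τ hτ => hs τ (Multiset.mem_cons_of_mem hτ)
    have hσ := hs σ (Multiset.mem_cons_self σ s)
    rw [Multiset.map_cons, Multiset.prod_cons, Multiset.card_cons, sub_mul, one_mul,
      Polynomial.coeff_sub, mul_assoc, Polynomial.coeff_C_mul]
    set q := (s.map fun σ => 1 - Polynomial.C σ * Polynomial.X).prod
    have hX : S.l1 ((Polynomial.X * q).coeff k) ≤ (1 + M) ^ s.card := by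
      rcases k with _ | k
      · simpa [l1] using pow_nonneg (by linarith : (0 : R) ≤ 1 + M) s.card
      · rw [Polynomial.coeff_X_mul]; exact ih' k
    have h1 := S.l1_add_le (q.coeff k) (-(σ * (Polynomial.X * q).coeff k))
    rw [← sub_eq_add_neg, S.l1_neg] at h1
    have h2 := S.l1_mul_le σ ((Polynomial.X * q).coeff k)
    have h3 := mul_le_mul hσ hX (S.l1_nonneg _) hM
    have h4 := ih' k
    rw [pow_succ]
    linarith

/-- When no root vanishes, p = p(0) ∏ (1 − X/ρ), so a bound on the inverse roots controls every
coefficient by p(0). -/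
theorem l1_coeff_le [IsAlgClosed K] {M : R} (hM : 0 ≤ M) (p : Polynomial K)
    (hp : ∀ ρ ∈ p.roots, ρ ≠ 0 ∧ S.l1 ρ⁻¹ ≤ M) (k : ℕ) :
    S.l1 (p.coeff k) ≤ S.l1 (p.eval 0) * (1 + M) ^ p.natDegree := by
  have hs := IsAlgClosed.splits p
  have h1 : p = Polynomial.C (p.eval 0) *
      ((p.roots.map (·⁻¹)).map fun σ => 1 - Polynomial.C σ * Polynomial.X).prod := by
    conv_lhs => rw [hs.eq_prod_roots]
    rw [hs.eval_eq_prod_roots, Polynomial.C_mul, mul_assoc, Multiset.map_map]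
    congr 1
    rw [map_multiset_prod, Multiset.map_map, ← Multiset.prod_map_mul]
    congr 1
    refine Multiset.map_congr rfl fun ρ hρ => ?_
    have h0 := (hp ρ hρ).1
    simp only [Function.comp_apply, zero_sub, mul_sub, mul_one, ← mul_assoc, ← Polynomial.C_mul,
      neg_mul, mul_inv_cancel₀ h0]
    simp; ring
  have h2 := S.l1_coeff_prod_le hM (p.roots.map (·⁻¹)) (by
    intro σ hσ
    obtain ⟨ρ, hρ, rfl⟩ := Multiset.mem_map.1 hσ
    exact (hp ρ hρ).2) k
  rw [Multiset.card_map, ← hs.natDegree_eq_card_roots] at h2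
  conv_lhs => rw [h1]
  rw [Polynomial.coeff_C_mul]
  exact (S.l1_mul_le _ _).trans (mul_le_mul_of_nonneg_left h2 (S.l1_nonneg _))

/-- Nonvanishing on the product of the open upper half-planes. -/
def Stable (f : MvPolynomial ι K) : Prop :=
  ∀ z : ι → K, (∀ k, 0 < S.im (z k)) → eval z f ≠ 0

/-- A limit of stable polynomials is stable or zero. -/
theorem hurwitz [IsAlgClosed K] [Fintype ι] (f g : MvPolynomial ι K)
    (h : ∀ ε : R, 0 < ε → S.Stable (f + C (algebraMap R K ε) * g)) : f = 0 ∨ S.Stable f := by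
  by_contra! hcon
  obtain ⟨hf0, hns⟩ := hcon
  simp only [Stable, not_forall, not_not] at hns
  obtain ⟨z, hz, hfz⟩ := hns
  -- On each real line through the zero z of f, the roots of f + εg stay away from 0 uniformly in ε.
  -- All coefficients of its restriction are thus controlled by the constant term ε g(z), and the
  -- coefficients of the restriction of f are O(ε) for every ε > 0, hence 0.
  have key : ∀ v : ι → R, eval (fun k => z k + algebraMap R K (v k)) f = 0 := by
    intro v
    -- With this r, the point z + vρ stays in the upper half-planes as long as |Im ρ| < r.
    obtain ⟨r, hr, hrv⟩ := exists_pos_le_forall (fun k => S.im (z k) / (|v k| + 1))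
      fun k => div_pos (hz k) (by positivity)
    let L : MvPolynomial ι K →ₐ[K] Polynomial K := aeval fun k =>
      Polynomial.C (z k) + Polynomial.C (algebraMap R K (v k)) * Polynomial.X
    have hL : ∀ (q : MvPolynomial ι K) (ζ : K),
        (L q).eval ζ = eval (fun k => z k + algebraMap R K (v k) * ζ) q := by
      intro q ζ
      change ((Polynomial.evalRingHom ζ).comp L.toRingHom) q = _
      refine DFunLike.congr_fun (MvPolynomial.ringHom_ext ?_ ?_) q
      · intro a; simp [L]
      · intro k; simp [L]
    have hroots : ∀ ε : R, 0 < ε → ∀ ρ ∈ (L (f + C (algebraMap R K ε) * g)).roots,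
        ρ ≠ 0 ∧ S.l1 ρ⁻¹ ≤ 2 / r := by
      intro ε hε ρ hρ
      have h1 := (Polynomial.mem_roots'.1 hρ).2
      rw [Polynomial.IsRoot, hL] at h1
      have h2 : r ≤ |S.im ρ| := by
        by_contra! hlt
        refine h ε hε _ (fun k => ?_) h1
        have h3 := (le_div_iff₀ (by positivity)).1 (hrv k)
        simp only [map_add, S.im_mul, S.re_algebraMap, S.im_algebraMap, zero_mul, add_zero]
        have h4 := neg_abs_le (v k * S.im ρ)
        rw [abs_mul] at h4
        nlinarith [abs_nonneg (v k)]
      refine ⟨?_, S.l1_inv_le hr h2⟩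
      rintro rfl
      simp at h2; linarith
    have hLf0 : (L f).eval 0 = 0 := by rw [hL]; simpa using hfz
    set N := max (L f).natDegree (L g).natDegree
    have hcoeff : ∀ k, (L f).coeff k = 0 := by
      intro k
      apply S.eq_zero_of_l1
      refine eq_zero_of_forall_pos_le_mul (S.l1_nonneg _)
        (B := S.l1 ((L g).eval 0) * (1 + 2 / r) ^ N + S.l1 ((L g).coeff k)) fun ε hε => ?_
      have hLe : L (f + C (algebraMap R K ε) * g)
          = L f + Polynomial.C (algebraMap R K ε) * L g := by
        rw [map_add, map_mul]; congr 2; simp [L]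
      have h1 := S.l1_coeff_le (M := 2 / r) (by positivity) _ (hroots ε hε) k
      rw [hLe] at h1
      have hdeg : (L f + Polynomial.C (algebraMap R K ε) * L g).natDegree ≤ N :=
        (Polynomial.natDegree_add_le _ _).trans
          (max_le_max le_rfl (Polynomial.natDegree_C_mul_le _ _))
      have h2 : (1 + 2 / r) ^ (L f + Polynomial.C (algebraMap R K ε) * L g).natDegree
          ≤ (1 + 2 / r) ^ N := pow_le_pow_right₀ (by simp; positivity) hdeg
      have h3 := S.l1_mul_le (algebraMap R K ε) ((L g).eval 0)
      have h4 := S.l1_mul_le (algebraMap R K ε) ((L g).coeff k)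
      rw [S.l1_algebraMap, abs_of_pos hε] at h3 h4
      simp only [Polynomial.eval_add, hLf0, Polynomial.eval_mul, Polynomial.eval_C, zero_add,
        Polynomial.coeff_add, Polynomial.coeff_C_mul] at h1
      have h5 := S.l1_add_le ((L f).coeff k + algebraMap R K ε * (L g).coeff k)
        (-(algebraMap R K ε * (L g).coeff k))
      rw [S.l1_neg, add_neg_cancel_right] at h5
      have h6 := mul_le_mul h3 h2 (by positivity) (mul_nonneg hε.le (S.l1_nonneg _))
      linarith
    have hLf : L f = 0 := Polynomial.ext fun k => by rw [hcoeff, Polynomial.coeff_zero]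
    have := hL f 1
    rw [hLf, Polynomial.eval_zero] at this
    simpa using this.symm
  -- f vanishes on z + Rⁿ, a product of infinite sets, so f = 0.
  refine hf0 (MvPolynomial.funext_set (fun k => Set.range fun a : R => z k + algebraMap R K a)
    (fun k => ?_) fun x hx => ?_)
  · exact Set.infinite_range_of_injective fun a b hab =>
      (algebraMap R K).injective (add_left_cancel hab)
  · choose v hv using fun k => hx k (Set.mem_univ k)
    have : x = fun k => z k + algebraMap R K (v k) := funext fun k => (hv k).symm
    rw [this, key, map_zero]

/-! ### Multiplier operators preserve stability -/

theorem im_inv_neg {w : K} (h : 0 < S.im w) : S.im w⁻¹ < 0 := by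
  have hw : w ≠ 0 := by rintro rfl; simp at h
  rw [S.im_inv]
  exact div_neg_of_neg_of_pos (by linarith) (S.normSq_pos hw)

/-- A zero would give κ = t Σ 1/(t − ρ). Multiplying by t and taking imaginary parts, κ Im t = Σ
Im(t²/(t − ρ)), where each summand is at most Im t; this contradicts κ > deg p. -/
theorem multiplier_high_ne_zero [IsAlgClosed K] {p : Polynomial K} {t : K} (ht : 0 < S.im t)
    (hpt : p.eval t ≠ 0) (hp : ∀ ρ ∈ p.roots, S.im ρ ≤ 0) {κ : R} (hκ : (p.natDegree : R) < κ) :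
    algebraMap R K κ * p.eval t - t * p.derivative.eval t ≠ 0 := by
  rw [(IsAlgClosed.splits p).eval_derivative_eq_eval_mul_sum hpt]
  intro h0
  have h1 : algebraMap R K κ = t * (p.roots.map fun z => 1 / (t - z)).sum :=
    mul_left_cancel₀ hpt (by linear_combination h0)
  have h2 : S.im (t * algebraMap R K κ)
      = (p.roots.map fun z => S.im (t * (t * (1 / (t - z))))).sum := by
    rw [h1, ← Multiset.sum_map_mul_left, ← Multiset.sum_map_mul_left, S.im_sum_multiset,
      Multiset.map_map]; rfl
  have h3 : (p.roots.map fun z => S.im (t * (t * (1 / (t - z))))).sum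
      ≤ Multiset.card p.roots • S.im t := by
    refine Multiset.sum_le_card_nsmul _ _ ?_ |>.trans (by rw [Multiset.card_map])
    intro x hx
    obtain ⟨ρ, hρ, rfl⟩ := Multiset.mem_map.1 hx
    have hρ' := hp ρ hρ
    have hne : t - ρ ≠ 0 := fun h => by rw [sub_eq_zero] at h; rw [h] at ht; linarith
    have hN := S.normSq_pos hne
    rw [one_div, S.im_mul t, S.im_mul t, S.re_mul t, S.re_inv, S.im_inv]
    have e1 : S.re t * (S.re t * (-S.im (t - ρ) / S.normSq (t - ρ)) +
        S.im t * (S.re (t - ρ) / S.normSq (t - ρ))) +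
        S.im t * (S.re t * (S.re (t - ρ) / S.normSq (t - ρ)) -
        S.im t * (-S.im (t - ρ) / S.normSq (t - ρ))) =
        (S.re t * (S.re t * (-S.im (t - ρ)) + S.im t * S.re (t - ρ)) +
        S.im t * (S.re t * S.re (t - ρ) - S.im t * (-S.im (t - ρ)))) / S.normSq (t - ρ) := by
      field_simp
    rw [e1, div_le_iff₀ hN]
    unfold normSq
    simp only [map_sub]
    -- The difference of the two sides is |ρ|² Im t − |t|² Im ρ.
    nlinarith [mul_nonneg (neg_nonneg.2 hρ') (sq_nonneg (S.re t)),
      mul_nonneg (neg_nonneg.2 hρ') (sq_nonneg (S.im t)),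
      mul_nonneg ht.le (sq_nonneg (S.re ρ)), mul_nonneg ht.le (sq_nonneg (S.im ρ))]
  rw [← (IsAlgClosed.splits p).natDegree_eq_card_roots, nsmul_eq_mul] at h3
  have h4 : S.im (t * algebraMap R K κ) = κ * S.im t := by simp [mul_comm]
  have := mul_lt_mul_of_pos_right hκ ht
  linarith

/-- A zero would give κ/t = Σ 1/(t − ρ), with positive imaginary part on the left and nonpositive on
the right. -/
theorem multiplier_neg_ne_zero [IsAlgClosed K] {p : Polynomial K} {t : K} (ht : 0 < S.im t)
    (hpt : p.eval t ≠ 0) (hp : ∀ ρ ∈ p.roots, S.im ρ ≤ 0) {κ : R} (hκ : κ < 0) :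
    algebraMap R K κ * p.eval t - t * p.derivative.eval t ≠ 0 := by
  have ht0 : t ≠ 0 := by rintro rfl; simp at ht
  rw [(IsAlgClosed.splits p).eval_derivative_eq_eval_mul_sum hpt]
  intro h0
  have h1 : algebraMap R K κ * t⁻¹ = (p.roots.map fun z => 1 / (t - z)).sum := by
    field_simp
    exact mul_left_cancel₀ hpt (by linear_combination h0)
  have h2 : S.im (algebraMap R K κ * t⁻¹) ≤ 0 := by
    rw [h1, S.im_sum_multiset, Multiset.map_map]
    refine (Multiset.sum_le_card_nsmul _ 0 fun x hx => ?_).trans (smul_zero _).le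
    obtain ⟨ρ, hρ, rfl⟩ := Multiset.mem_map.1 hx
    simp only [Function.comp_apply, one_div]
    refine (S.im_inv_neg ?_).le
    rw [map_sub]
    linarith [hp ρ hρ]
  have h3 := mul_pos_of_neg_of_neg hκ (S.im_inv_neg ht)
  simp only [S.im_mul, S.re_algebraMap, S.im_algebraMap, zero_mul, add_zero] at h2
  linarith

/-- For p = X^m q the expression is t^m ((κ − m) q(t) − t q'(t)), which reduces to a negative
multiplier. -/
theorem multiplier_low_ne_zero [IsAlgClosed K] {p : Polynomial K} {t : K} (ht : 0 < S.im t)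
    (hpt : p.eval t ≠ 0) (hp : ∀ ρ ∈ p.roots, S.im ρ ≤ 0) {κ : R} {m : ℕ}
    (hm : Polynomial.X ^ m ∣ p) (hκ : κ < m) :
    algebraMap R K κ * p.eval t - t * p.derivative.eval t ≠ 0 := by
  obtain ⟨q, rfl⟩ := hm
  have hq0 : (Polynomial.X ^ m * q) ≠ 0 := by rintro h; simp [h] at hpt
  have ht0 : t ≠ 0 := by rintro rfl; simp at ht
  have hqt : q.eval t ≠ 0 := by
    rw [Polynomial.eval_mul] at hpt; exact right_ne_zero_of_mul hpt
  have h1 := S.multiplier_neg_ne_zero ht hqt (fun ρ hρ => hp ρ (by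
    rw [Polynomial.roots_mul hq0]; exact Multiset.mem_add.2 (.inr hρ)))
    (κ := κ - m) (by linarith)
  intro h0
  refine h1 (mul_left_cancel₀ (pow_ne_zero m ht0) ?_)
  rw [mul_zero, ← h0]
  simp only [Polynomial.derivative_mul, Polynomial.derivative_X_pow, Polynomial.eval_mul,
    Polynomial.eval_pow, Polynomial.eval_X, Polynomial.eval_add, Polynomial.eval_natCast, map_sub,
    map_natCast]
  rcases m with _ | m
  · simp
  · simp only [Nat.add_sub_cancel, pow_succ]; ring

variable [IsAlgClosed K] [Fintype ι] {f : MvPolynomial ι K}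

theorem im_root_fiber (hf : S.Stable f) {z : ι → K} (hz : ∀ k, 0 < S.im (z k)) (k : ι) :
    ∀ ρ ∈ (fiber f z k).roots, S.im ρ ≤ 0 := by
  classical
  intro ρ hρ
  by_contra! hlt
  have h := (Polynomial.mem_roots'.1 hρ).2
  rw [Polynomial.IsRoot, eval_fiber] at h
  refine hf _ (fun l => ?_) h
  rcases eq_or_ne l k with rfl | hl
  · simpa using hlt
  · simpa [hl] using hz l

theorem stable_wt_of_lt (hf : S.Stable f) (k : ι) {κ : R} {D : ℕ} (h : ∀ u ∈ f.support, u k ≤ D)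
    (hD : (D : R) < κ) : S.Stable (wt (fun u => κ - (u k : R)) f) := fun z hz => by
  rw [eval_wt_sub]
  exact S.multiplier_high_ne_zero (hz k) (by rw [eval_fiber_self]; exact hf z hz)
    (S.im_root_fiber hf hz k)
    (lt_of_le_of_lt (Nat.cast_le.2 (natDegree_fiber_le f z k h)) hD)

theorem stable_wt_of_gt (hf : S.Stable f) (k : ι) {κ : R} {D : ℕ} (h : ∀ u ∈ f.support, D ≤ u k)
    (hD : κ < D) : S.Stable (wt (fun u => κ - (u k : R)) f) := fun z hz => by
  rw [eval_wt_sub]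
  exact S.multiplier_low_ne_zero (hz k) (by rw [eval_fiber_self]; exact hf z hz)
    (S.im_root_fiber hf hz k) (X_pow_dvd_fiber f z k h) hD

/-- The boundary case κ = D is the limit of κ = D + ε, whose operator adds ε f. The result is 0 when
every exponent of x_k equals D. -/
theorem stable_wt_top (hf : S.Stable f) (k : ι) {D : ℕ} (h : ∀ u ∈ f.support, u k ≤ D) :
    wt (fun u => (D : R) - (u k : R)) f = 0 ∨ S.Stable (wt (fun u => (D : R) - (u k : R)) f) := by
  refine S.hurwitz _ f fun ε hε => ?_
  convert S.stable_wt_of_lt hf k h (κ := D + ε) (by linarith) using 1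
  ext u
  simp only [coeff_add, coeff_wt, coeff_C_mul, map_sub, map_add]; ring

theorem stable_wt_bot (hf : S.Stable f) (k : ι) {D : ℕ} (h : ∀ u ∈ f.support, D ≤ u k) :
    wt (fun u => (u k : R) - D) f = 0 ∨ S.Stable (wt (fun u => (u k : R) - D) f) := by
  refine S.hurwitz _ f fun ε hε z hz h0 => ?_
  refine S.stable_wt_of_gt hf k h (κ := D - ε) (by linarith) z hz ?_
  rw [← neg_eq_zero, ← h0, ← map_neg]
  congr 1
  ext u
  simp only [coeff_neg, coeff_add, coeff_wt, coeff_C_mul, map_sub]; ring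

end CartesianCoords

theorem sum_eq_of_mem_support {A ι : Type*} [CommSemiring A] [Fintype ι] {f : MvPolynomial ι A}
    {d : ℕ} (hf : f.IsHomogeneous d) {u : ι →₀ ℕ} (hu : u ∈ f.support) : ∑ k, u k = d := by
  rw [← Finsupp.degree_eq_sum]
  by_contra h
  exact mem_support_iff.1 hu (hf.coeff_eq_zero h)

theorem le_of_mem_support {A ι : Type*} [CommSemiring A] [Fintype ι] {f : MvPolynomial ι A}
    {d : ℕ} (hf : f.IsHomogeneous d) {u : ι →₀ ℕ} (hu : u ∈ f.support) (k : ι) : u k ≤ d := by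
  rw [← sum_eq_of_mem_support hf hu]
  exact Finset.single_le_sum (f := fun k => u k) (fun _ _ => Nat.zero_le _) (Finset.mem_univ k)

theorem eval_mul_of_isHomogeneous {A ι : Type*} [CommSemiring A] [Fintype ι]
    {f : MvPolynomial ι A} {d : ℕ} (hf : f.IsHomogeneous d) (a : A) (z : ι → A) :
    eval (fun k => a * z k) f = a ^ d * eval z f := by
  rw [eval_eq', eval_eq', Finset.mul_sum]
  refine Finset.sum_congr rfl fun u hu => ?_
  simp only [mul_pow, Finset.prod_mul_distrib, Finset.prod_pow_eq_pow_sum,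
    sum_eq_of_mem_support hf hu]
  ring

/-! ### Weights cutting out an exponent box -/

/-- A natural number weight on `{0, …, D}` that is positive exactly on `{l, …, h}`. -/
def boxWeight (l h D m : ℕ) : ℕ :=
  (∏ j ∈ Finset.range l, (m - j)) * ∏ j ∈ Finset.range (D - h), (h + j + 1 - m)

theorem boxWeight_pos {l h m : ℕ} (D : ℕ) (hl : l ≤ m) (hh : m ≤ h) : 0 < boxWeight l h D m := by
  refine Nat.mul_pos (Finset.prod_pos fun j hj => ?_) (Finset.prod_pos fun j hj => ?_)
  · have := Finset.mem_range.1 hj; omega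
  · omega

theorem boxWeight_eq_zero_of_lt {l h D m : ℕ} (hm : m < l) : boxWeight l h D m = 0 := by
  rw [boxWeight, Finset.prod_eq_zero (Finset.mem_range.2 hm) (by simp), zero_mul]

/-- The vanishing factor is the one of index m − h − 1; the bound m ≤ D puts it in range. -/
theorem boxWeight_eq_zero_of_gt {l h D m : ℕ} (hm : h < m) (hD : m ≤ D) :
    boxWeight l h D m = 0 := by
  rw [boxWeight, Finset.prod_eq_zero (s := Finset.range (D - h)) (i := m - h - 1)
    (Finset.mem_range.2 (by omega)) (by omega), mul_zero]

section

variable {R K ι : Type*} [Field R] [Field K] [Algebra R K]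

theorem wt_congr {ω ω' : (ι →₀ ℕ) → R} {f : MvPolynomial ι K}
    (h : ∀ u ∈ f.support, ω u = ω' u) : wt ω f = wt ω' f := by
  ext u
  rw [coeff_wt, coeff_wt]
  by_cases hu : u ∈ f.support
  · rw [h u hu]
  · rw [notMem_support_iff.1 hu, mul_zero, mul_zero]

theorem wt_one (f : MvPolynomial ι K) : wt (fun _ => (1 : R)) f = f := by
  ext u; simp

end

/-! ### Stable forms at the point (1,…,1), and the common phase of the coefficients. -/

namespace CartesianCoords

variable {R K ι : Type*} [Field R] [LinearOrder R] [IsStrictOrderedRing R]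
  [Field K] [Algebra R K] (S : CartesianCoords R K) [Fintype ι]

theorem eval_ne_zero_of_rotate {f : MvPolynomial ι K} {d : ℕ} (hd : f.IsHomogeneous d)
    (hf : S.Stable f) {z : ι → K} {ω : K} (h : ∀ k, 0 < S.im (ω * z k)) : eval z f ≠ 0 :=
  fun h0 => hf _ h (by rw [eval_mul_of_isHomogeneous hd, h0, mul_zero])

/-- Homogeneity allows all coordinates to be multiplied by ω = M + i, which for large M moves them
into the open upper half-plane. A real coordinate contributes 0 to M because a / 0 = 0. -/
theorem eval_ne_zero_of_upper {f : MvPolynomial ι K} {d : ℕ} (hd : f.IsHomogeneous d)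
    (hf : S.Stable f) {z : ι → K} (hz : ∀ k, 0 < S.im (z k) ∨ S.im (z k) = 0 ∧ 0 < S.re (z k)) :
    eval z f ≠ 0 := by
  have h0 : ∀ k, 0 ≤ |S.re (z k)| / |S.im (z k)| := fun k => by positivity
  refine S.eval_ne_zero_of_rotate hd hf
    (ω := algebraMap R K (1 + ∑ k, |S.re (z k)| / |S.im (z k)|) + S.i) fun k => ?_
  have h1 := Finset.single_le_sum (fun k _ => h0 k) (Finset.mem_univ k)
  simp only [S.im_mul, map_add S.re, map_add S.im, S.re_algebraMap, S.im_algebraMap, S.re_i,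
    S.im_i, add_zero, zero_add, one_mul]
  rcases hz k with h | ⟨h, h'⟩
  · rw [div_le_iff₀ (abs_pos.2 h.ne'), abs_of_pos h] at h1
    have := neg_abs_le (S.re (z k))
    nlinarith
  · rw [h]; linarith

theorem eval_ne_zero_of_lower {f : MvPolynomial ι K} {d : ℕ} (hd : f.IsHomogeneous d)
    (hf : S.Stable f) {z : ι → K} (hz : ∀ k, S.im (z k) < 0 ∨ S.im (z k) = 0 ∧ 0 < S.re (z k)) :
    eval z f ≠ 0 := by
  have h0 : ∀ k, 0 ≤ |S.re (z k)| / |S.im (z k)| := fun k => by positivity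
  refine S.eval_ne_zero_of_rotate hd hf
    (ω := algebraMap R K (-(1 + ∑ k, |S.re (z k)| / |S.im (z k)|)) + S.i) fun k => ?_
  have h1 := Finset.single_le_sum (fun k _ => h0 k) (Finset.mem_univ k)
  simp only [S.im_mul, map_add S.re, map_add S.im, S.re_algebraMap, S.im_algebraMap, S.re_i,
    S.im_i, add_zero, zero_add, one_mul]
  rcases hz k with h | ⟨h, h'⟩
  · rw [div_le_iff₀ (abs_pos.2 h.ne), abs_of_neg h] at h1
    have := neg_abs_le (S.re (z k))
    nlinarith
  · rw [h]; linarith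

theorem eval_one_ne_zero {f : MvPolynomial ι K} {d : ℕ} (hd : f.IsHomogeneous d)
    (hf : S.Stable f) : eval 1 f ≠ 0 :=
  S.eval_ne_zero_of_upper hd hf fun k => .inr (by simp)

/-- A nonreal or positive root would be a zero of f with all other coordinates 1, against
`eval_ne_zero_of_upper` or `eval_ne_zero_of_lower`. -/
theorem root_fiber_one {f : MvPolynomial ι K} {d : ℕ} (hd : f.IsHomogeneous d)
    (hf : S.Stable f) (k : ι) {ρ : K} (hρ : ρ ∈ (fiber f 1 k).roots) :
    S.im ρ = 0 ∧ S.re ρ ≤ 0 := by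
  classical
  have h := (Polynomial.mem_roots'.1 hρ).2
  rw [Polynomial.IsRoot, eval_fiber] at h
  by_contra! hcon
  rcases lt_trichotomy (S.im ρ) 0 with h1 | h1 | h1
  · refine S.eval_ne_zero_of_lower hd hf (fun l => ?_) h
    rcases eq_or_ne l k with rfl | hl
    · simp [h1]
    · simp [hl]
  · refine S.eval_ne_zero_of_upper hd hf (fun l => ?_) h
    rcases eq_or_ne l k with rfl | hl
    · simp [h1, hcon h1]
    · simp [hl]
  · refine S.eval_ne_zero_of_upper hd hf (fun l => ?_) h
    rcases eq_or_ne l k with rfl | hl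
    · simp [h1]
    · simp [hl]

theorem sum_one_div_one_sub (s : Multiset K) (hs : ∀ ρ ∈ s, S.im ρ = 0 ∧ S.re ρ ≤ 0) :
    ∃ r : R, 0 ≤ r ∧ r ≤ s.card ∧ (s.map fun z => 1 / (1 - z)).sum = algebraMap R K r := by
  induction s using Multiset.induction_on with
  | empty => exact ⟨0, by simp⟩
  | cons ρ s ih =>
    obtain ⟨r, hr0, hr1, hr⟩ := ih fun τ hτ => hs τ (Multiset.mem_cons_of_mem hτ)
    obtain ⟨h1, h2⟩ := hs ρ (Multiset.mem_cons_self ρ s)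
    have hρ : ρ = algebraMap R K (S.re ρ) := by rw [S.ext_iff']; simp [h1]
    refine ⟨1 / (1 - S.re ρ) + r, ?_, ?_, ?_⟩
    · have : 0 ≤ 1 / (1 - S.re ρ) := by apply div_nonneg <;> linarith
      linarith
    · have : 1 / (1 - S.re ρ) ≤ 1 := by rw [div_le_one] <;> linarith
      rw [Multiset.card_cons]; push_cast; linarith
    · rw [Multiset.map_cons, Multiset.sum_cons, hr, map_add, map_div₀, map_sub, map_one, ← hρ]

variable [IsAlgClosed K]

/-- Write the fiber as X^a q. Its logarithmic derivative at 1 is a + Σ 1/(1 − ρ) over the roots ρ ≤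
0 of q, and each summand lies in [0, 1]. -/
theorem eval_derivative_fiber_one {f : MvPolynomial ι K} {d : ℕ} (hd : f.IsHomogeneous d)
    (hf : S.Stable f) (k : ι) {a b : ℕ} (ha : ∀ u ∈ f.support, a ≤ u k)
    (hb : ∀ u ∈ f.support, u k ≤ b) : ∃ r : R, a ≤ r ∧ r ≤ b ∧
      (fiber f 1 k).derivative.eval 1 = algebraMap R K r * eval 1 f := by
  have h1 := eval_fiber_self f 1 k
  have hne := S.eval_one_ne_zero hd hf
  have hdeg := natDegree_fiber_le f 1 k hb
  have hroots := fun ρ => S.root_fiber_one hd hf k (ρ := ρ)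
  obtain ⟨q, hq⟩ := X_pow_dvd_fiber f 1 k ha
  rw [Pi.one_apply] at h1
  rw [← h1] at hne ⊢
  rw [hq] at hne hdeg hroots ⊢
  have hpq : Polynomial.X ^ a * q ≠ 0 := by rintro h; simp [h] at hne
  have hq0 : q ≠ 0 := right_ne_zero_of_mul hpq
  have hq1 : q.eval 1 ≠ 0 := by simpa using hne
  obtain ⟨r, hr0, hr1, hr⟩ := S.sum_one_div_one_sub q.roots fun ρ hρ => hroots ρ (by
    rw [Polynomial.roots_mul hpq]; exact Multiset.mem_add.2 (.inr hρ))
  rw [← (IsAlgClosed.splits q).natDegree_eq_card_roots] at hr1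
  rw [Polynomial.natDegree_mul (pow_ne_zero _ Polynomial.X_ne_zero) hq0,
    Polynomial.natDegree_X_pow] at hdeg
  have hdeg' : (a : R) + q.natDegree ≤ b := by exact_mod_cast hdeg
  refine ⟨a + r, by linarith, by linarith, ?_⟩
  have hder := (IsAlgClosed.splits q).eval_derivative_eq_eval_mul_sum hq1
  rw [hr] at hder
  simp only [Polynomial.derivative_mul, Polynomial.derivative_X_pow, Polynomial.eval_mul,
    Polynomial.eval_pow, Polynomial.eval_X, Polynomial.eval_add, Polynomial.eval_natCast, hder,
    map_natCast, map_add, one_pow]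
  ring

/-- `g` is stable or zero, and `g(1) = r f(1)` for some `r ≥ 0`. -/
def Reduct (f g : MvPolynomial ι K) : Prop :=
  (g = 0 ∨ S.Stable g) ∧ ∃ r : R, 0 ≤ r ∧ eval 1 g = algebraMap R K r * eval 1 f

variable {S} in
theorem Reduct.trans {f g h : MvPolynomial ι K} (h1 : S.Reduct f g) (h2 : S.Reduct g h) :
    S.Reduct f h := by
  obtain ⟨-, r, hr, hr'⟩ := h1
  obtain ⟨h3, s, hs, hs'⟩ := h2
  exact ⟨h3, s * r, mul_nonneg hs hr, by rw [hs', hr', map_mul, mul_assoc]⟩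

theorem reduct_wt_top {f : MvPolynomial ι K} {d : ℕ} (hd : f.IsHomogeneous d)
    (hf : f = 0 ∨ S.Stable f) (k : ι) {D : ℕ} (h : ∀ u ∈ f.support, u k ≤ D) :
    S.Reduct f (wt (fun u => (D : R) - (u k : R)) f) := by
  rcases hf with rfl | hf
  · have : wt (fun u : ι →₀ ℕ => (D : R) - (u k : R)) (0 : MvPolynomial ι K) = 0 := by
      ext u; simp
    rw [this]
    exact ⟨.inl rfl, 0, le_rfl, by simp⟩
  · refine ⟨S.stable_wt_top hf k h, ?_⟩
    obtain ⟨r, -, hr, hr'⟩ := S.eval_derivative_fiber_one hd hf k (a := 0) (by simp) h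
    refine ⟨D - r, by linarith, ?_⟩
    rw [eval_wt_sub, eval_fiber_self, Pi.one_apply, hr', map_sub]
    ring

theorem reduct_wt_bot {f : MvPolynomial ι K} {d : ℕ} (hd : f.IsHomogeneous d)
    (hf : f = 0 ∨ S.Stable f) (k : ι) {D : ℕ} (h : ∀ u ∈ f.support, D ≤ u k) :
    S.Reduct f (wt (fun u => (u k : R) - D) f) := by
  rcases hf with rfl | hf
  · have : wt (fun u : ι →₀ ℕ => (u k : R) - D) (0 : MvPolynomial ι K) = 0 := by
      ext u; simp
    rw [this]
    exact ⟨.inl rfl, 0, le_rfl, by simp⟩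
  · refine ⟨S.stable_wt_bot hf k h, ?_⟩
    obtain ⟨r, hr, -, hr'⟩ := S.eval_derivative_fiber_one hd hf k h
      (fun u hu => le_of_mem_support hd hu k)
    refine ⟨r - D, by linarith, ?_⟩
    have h1 : wt (fun u : ι →₀ ℕ => (u k : R) - D) f
        = -wt (fun u : ι →₀ ℕ => (D : R) - (u k : R)) f := by
      ext u; simp only [coeff_neg, coeff_wt, map_sub]; ring
    rw [h1, map_neg, eval_wt_sub, eval_fiber_self, Pi.one_apply, hr', map_sub]
    ring

/-- Each factor kills the largest exponent of x_k still allowed, so the next factor is again a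
boundary operator. -/
theorem reduct_wt_upper {f : MvPolynomial ι K} {d : ℕ} (hd : f.IsHomogeneous d)
    (hf : f = 0 ∨ S.Stable f) (k : ι) (h m : ℕ) (hm : ∀ u ∈ f.support, u k ≤ h + m) :
    S.Reduct f (wt (fun u => ((∏ j ∈ Finset.range m, (h + j + 1 - u k) : ℕ) : R)) f) := by
  induction m generalizing f with
  | zero =>
    simp only [Finset.range_zero, Finset.prod_empty, Nat.cast_one, wt_one]
    exact ⟨hf, 1, zero_le_one, by simp⟩
  | succ m ih =>
    have h1 := S.reduct_wt_top hd hf k hm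
    refine h1.trans ?_
    convert ih (isHomogeneous_wt _ hd) h1.1 fun u hu => ?_ using 1
    · rw [wt_wt]
      refine wt_congr fun u hu => ?_
      rw [Finset.prod_range_succ, Nat.cast_mul, Nat.cast_sub (by have := hm u hu; omega)]
      push_cast; ring
    · have h2 := hm u (support_wt_subset _ _ hu)
      have h3 : u k ≠ h + (m + 1) := fun h3 => by
        rw [mem_support_iff, coeff_wt, h3] at hu
        simp at hu
      omega

theorem reduct_wt_lower {f : MvPolynomial ι K} {d : ℕ} (hd : f.IsHomogeneous d)
    (hf : f = 0 ∨ S.Stable f) (k : ι) (l : ℕ) :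
    S.Reduct f (wt (fun u => ((∏ j ∈ Finset.range l, (u k - j) : ℕ) : R)) f) := by
  induction l with
  | zero =>
    simp only [Finset.range_zero, Finset.prod_empty, Nat.cast_one, wt_one]
    exact ⟨hf, 1, zero_le_one, by simp⟩
  | succ l ih =>
    have hl : ∀ u ∈ (wt (fun u => ((∏ j ∈ Finset.range l, (u k - j) : ℕ) : R)) f).support,
        l ≤ u k := fun u hu => by
      by_contra! hlt
      rw [mem_support_iff, coeff_wt,
        Finset.prod_eq_zero (Finset.mem_range.2 hlt) (Nat.sub_self _)] at hu
      simp at hu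
    refine ih.trans ?_
    convert S.reduct_wt_bot (isHomogeneous_wt _ hd) ih.1 k hl using 1
    rw [wt_wt]
    ext u
    rw [coeff_wt, coeff_wt]
    congr 2
    rw [Finset.prod_range_succ]
    rcases le_or_gt l (u k) with h | h
    · rw [Nat.cast_mul, Nat.cast_sub h, mul_comm]
    · rw [Finset.prod_eq_zero (Finset.mem_range.2 h) (Nat.sub_self _)]; simp

theorem reduct_wt_boxWeight {f : MvPolynomial ι K} {d : ℕ} (hd : f.IsHomogeneous d)
    (hf : f = 0 ∨ S.Stable f) (k : ι) (l h : ℕ) :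
    S.Reduct f (wt (fun u => (boxWeight l h d (u k) : R)) f) := by
  have h1 := S.reduct_wt_upper hd hf k h (d - h) fun u hu => by
    have := le_of_mem_support hd hu k; omega
  refine h1.trans ?_
  convert S.reduct_wt_lower (isHomogeneous_wt _ hd) h1.1 k l using 1
  rw [wt_wt]
  simp only [boxWeight, Nat.cast_mul]

theorem reduct_wt_box {f : MvPolynomial ι K} {d : ℕ} (hd : f.IsHomogeneous d)
    (hf : f = 0 ∨ S.Stable f) (l h : ι → ℕ) (s : Finset ι) :
    S.Reduct f (wt (fun u => ((∏ k ∈ s, boxWeight (l k) (h k) d (u k) : ℕ) : R)) f) := by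
  classical
  induction s using Finset.induction_on with
  | empty =>
    simp only [Finset.prod_empty, Nat.cast_one, wt_one]
    exact ⟨hf, 1, zero_le_one, by simp⟩
  | insert k s hk ih =>
    refine ih.trans ?_
    convert S.reduct_wt_boxWeight (isHomogeneous_wt _ hd) ih.1 k (l k) (h k) using 1
    rw [wt_wt]
    simp only [Finset.prod_insert hk, Nat.cast_mul]

/-- The coefficients of a homogeneous stable polynomial have the same phase. -/
theorem coeff_eq_mul_eval_one {f : MvPolynomial ι K} {d : ℕ} (hd : f.IsHomogeneous d)
    (hf : S.Stable f) (u : ι →₀ ℕ) :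
    ∃ r : R, 0 ≤ r ∧ coeff u f = algebraMap R K r * eval 1 f := by
  by_cases hu : u ∈ f.support
  swap
  · exact ⟨0, le_rfl, by rw [notMem_support_iff.1 hu]; simp⟩
  -- The box with both corners u leaves only the monomial x^u, whose value at (1,…,1) is a positive
  -- multiple of its coefficient.
  obtain ⟨-, r, hr, hr'⟩ := S.reduct_wt_box hd (.inr hf) u u Finset.univ
  have hpos : 0 < ∏ k, boxWeight (u k) (u k) d (u k) :=
    Finset.prod_pos fun k _ => boxWeight_pos _ le_rfl le_rfl
  set N := ∏ k, boxWeight (u k) (u k) d (u k)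
  have hN : (0 : R) < N := Nat.cast_pos.2 hpos
  rw [eval_wt, Finset.sum_eq_single u] at hr'
  · refine ⟨r / N, by positivity, ?_⟩
    have hN' : algebraMap R K N ≠ 0 := by
      rw [Ne, map_eq_zero]; exact hN.ne'
    simp only [Pi.one_apply, one_pow, Finset.prod_const_one, mul_one] at hr'
    rw [map_div₀, div_mul_eq_mul_div, ← hr', mul_div_cancel_left₀ _ hN']
  · intro v hv hne
    obtain ⟨k, hk⟩ : ∃ k, v k ≠ u k := by
      by_contra! hcon
      exact hne (Finsupp.ext hcon)
    have : boxWeight (u k) (u k) d (v k) = 0 := by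
      rcases lt_or_gt_of_ne hk with h | h
      · exact boxWeight_eq_zero_of_lt h
      · exact boxWeight_eq_zero_of_gt h (le_of_mem_support hd hv k)
    rw [Finset.prod_eq_zero (Finset.mem_univ k) this]
    simp
  · exact fun h => absurd hu h

end CartesianCoords

/-! ### Ternary forms: inequalities between neighbouring coefficients. -/

/-- The exponent vector of `x^p y^q z^r`. -/
def expo (p q r : ℕ) : Fin 3 →₀ ℕ := Finsupp.equivFunOnFinite.symm ![p, q, r]

@[simp] theorem expo_zero (p q r : ℕ) : expo p q r 0 = p := rfl

@[simp] theorem expo_one (p q r : ℕ) : expo p q r 1 = q := rfl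

@[simp] theorem expo_two (p q r : ℕ) : expo p q r 2 = r := rfl

theorem degree_expo (p q r : ℕ) : (expo p q r).degree = p + q + r := by
  rw [Finsupp.degree_eq_sum, Fin.sum_univ_three]; rfl

theorem eq_expo {A : Type*} [CommSemiring A] {g : MvPolynomial (Fin 3) A} {d : ℕ}
    (hd : g.IsHomogeneous d) {u : Fin 3 →₀ ℕ} (hu : u ∈ g.support) :
    u = expo (u 0) (u 1) (d - u 0 - u 1) := by
  have h := sum_eq_of_mem_support hd hu
  rw [Fin.sum_univ_three] at h
  ext k
  fin_cases k
  · rfl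
  · rfl
  · change u 2 = d - u 0 - u 1; omega

/-- The coefficient of `x^p y^q z^(d-p-q)`. -/
def tcoeff {A : Type*} [CommSemiring A] (d : ℕ) (g : MvPolynomial (Fin 3) A) (p q : ℕ) : A :=
  coeff (expo p q (d - p - q)) g

namespace CartesianCoords

variable {R K : Type*} [Field R] [LinearOrder R] [IsStrictOrderedRing R]
  [Field K] [Algebra R K] (S : CartesianCoords R K) [IsAlgClosed K]

theorem eval_wt_box {g : MvPolynomial (Fin 3) R} {d : ℕ} (hd : g.IsHomogeneous d) {p q m n : ℕ}
    (ξ σ : K) :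
    eval ![ξ, σ, 1] (wt (fun u => ((∏ k ∈ {0, 1}, boxWeight (![p, q] k) (![p + m, q + n] k) d
        (u (Fin.castSucc k)) : ℕ) : R)) (map (algebraMap R K) g)) =
      ∑ a ∈ Finset.range (m + 1), ∑ b ∈ Finset.range (n + 1),
        algebraMap R K (boxWeight p (p + m) d (p + a) * boxWeight q (q + n) d (q + b) *
          tcoeff d g (p + a) (q + b)) * (ξ ^ (p + a) * σ ^ (q + b)) := by
  have hd' := hd.map (algebraMap R K)
  rw [eval_wt, ← Finset.sum_product']
  have hinj : Set.InjOn (fun ab : ℕ × ℕ => expo (p + ab.1) (q + ab.2) (d - (p + ab.1) - (q + ab.2)))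
      (Finset.range (m + 1) ×ˢ Finset.range (n + 1) : Finset (ℕ × ℕ)) := by
    intro ab _ ab' _ h
    have h0 := DFunLike.congr_fun h 0
    have h1 := DFunLike.congr_fun h 1
    simp only [expo_zero, expo_one, Nat.add_left_cancel_iff] at h0 h1
    exact Prod.ext h0 h1
  refine Eq.trans ?_ ((Finset.sum_image (f := fun u => algebraMap R K
    ((∏ k ∈ {0, 1}, boxWeight (![p, q] k) (![p + m, q + n] k) d (u (Fin.castSucc k)) : ℕ) : R) *
    (coeff u (map (algebraMap R K) g) * ∏ k, (![ξ, σ, 1] : Fin 3 → K) k ^ u k)) hinj).trans ?_)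
  · set T := Finset.image (fun ab : ℕ × ℕ => expo (p + ab.1) (q + ab.2)
      (d - (p + ab.1) - (q + ab.2))) (Finset.range (m + 1) ×ˢ Finset.range (n + 1)) with hT
    refine (Finset.sum_subset (Finset.subset_union_left (s₂ := T)) ?_).trans
      (Finset.sum_subset Finset.subset_union_right ?_).symm
    rotate_left
    · intro u hu hu'
      rcases Finset.mem_union.1 hu with h | h
      swap
      · exact absurd h hu'
      have hx := eq_expo hd' h
      have h0 := le_of_mem_support hd' h 0
      have h1 := le_of_mem_support hd' h 1
      suffices hs : boxWeight p (p + m) d (u 0) * boxWeight q (q + n) d (u 1) = 0 by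
        have : ∏ k ∈ ({0, 1} : Finset (Fin 2)), boxWeight (![p, q] k) (![p + m, q + n] k) d
            (u (Fin.castSucc k)) = 0 := by
          rw [Finset.prod_pair (by decide)]; exact hs
        rw [this]; simp
      by_contra hne
      have h2 := left_ne_zero_of_mul hne
      have h3 := right_ne_zero_of_mul hne
      have a1 : p ≤ u 0 := by by_contra! hl; exact h2 (boxWeight_eq_zero_of_lt hl)
      have a2 : u 0 ≤ p + m := by by_contra! hl; exact h2 (boxWeight_eq_zero_of_gt hl h0)
      have a3 : q ≤ u 1 := by by_contra! hl; exact h3 (boxWeight_eq_zero_of_lt hl)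
      have a4 : u 1 ≤ q + n := by by_contra! hl; exact h3 (boxWeight_eq_zero_of_gt hl h1)
      refine hu' (Finset.mem_image.2 ⟨(u 0 - p, u 1 - q), ?_, ?_⟩)
      · simp only [Finset.mem_product, Finset.mem_range]; omega
      · conv_rhs => rw [hx]
        simp only [Nat.add_sub_cancel' a1, Nat.add_sub_cancel' a3]
    · intro u _ hu
      rw [notMem_support_iff.1 hu]; simp
  · refine Finset.sum_congr rfl fun ab _ => ?_
    rw [Finset.prod_pair (by decide), Fin.prod_univ_three, coeff_map]
    simp only [tcoeff, map_mul, Nat.cast_mul]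
    have e0 : (Fin.castSucc (0 : Fin 2)) = 0 := rfl
    have e1 : (Fin.castSucc (1 : Fin 2)) = 1 := rfl
    simp [e0, e1]
    ring

/-- The truncation to the box is nonzero because its corner coefficient survives, hence it is
stable; homogeneity permits the third variable to be the positive real 1. -/
theorem eval_wt_box_ne_zero {g : MvPolynomial (Fin 3) R} {d : ℕ} (hd : g.IsHomogeneous d)
    (hg : S.Stable (map (algebraMap R K) g)) {p q m n : ℕ}
    (h0 : tcoeff d g p q ≠ 0) {ξ σ : K} (hξ : 0 < S.im ξ) (hσ : 0 < S.im σ) :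
    ∑ a ∈ Finset.range (m + 1), ∑ b ∈ Finset.range (n + 1),
        algebraMap R K (boxWeight p (p + m) d (p + a) * boxWeight q (q + n) d (q + b) *
          tcoeff d g (p + a) (q + b)) * (ξ ^ (p + a) * σ ^ (q + b)) ≠ 0 := by
  have hd' := hd.map (algebraMap R K)
  rw [← eval_wt_box hd]
  -- The third entries of the bounds are placeholders: only the variables 0 and 1 are weighted.
  have h1 := S.reduct_wt_box hd' (.inr hg) ![p, q, 0] ![p + m, q + n, d] {0, 1}
  have e : (fun u : Fin 3 →₀ ℕ => ((∏ k ∈ {0, 1}, boxWeight (![p, q] k) (![p + m, q + n] k) d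
      (u (Fin.castSucc k)) : ℕ) : R)) = fun u => ((∏ k ∈ {0, 1}, boxWeight (![p, q, 0] k)
      (![p + m, q + n, d] k) d (u k) : ℕ) : R) := by
    funext u
    rw [Finset.prod_pair (by decide), Finset.prod_pair (by decide)]
    rfl
  rw [e]
  rcases h1.1 with h2 | h2
  · exfalso
    have h3 := congr_arg (coeff (expo p q (d - p - q))) h2
    rw [coeff_wt, coeff_map, coeff_zero, Finset.prod_pair (by decide), mul_eq_zero, map_eq_zero,
      map_eq_zero] at h3
    rcases h3 with h3 | h3
    · have a := boxWeight_pos d (le_refl p) (Nat.le_add_right p m)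
      have b := boxWeight_pos d (le_refl q) (Nat.le_add_right q n)
      exact (Nat.mul_pos a b).ne' (by exact_mod_cast h3)
    · exact h0 h3
  · refine S.eval_ne_zero_of_upper (isHomogeneous_wt _ hd') h2 fun k => ?_
    fin_cases k
    · exact .inl hξ
    · exact .inl hσ
    · exact .inr (by simp)

/-- For σ = i the expression is affine in ξ with zero −(a + ic)/(b + ie), of imaginary part (ae −
bc)/(b² + e²). -/
theorem bilinear_ineq {a b c e : R} (hb : 0 < b)
    (h : ∀ ξ σ : K, 0 < S.im ξ → 0 < S.im σ → algebraMap R K a + algebraMap R K b * ξ +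
      algebraMap R K c * σ + algebraMap R K e * (ξ * σ) ≠ 0) : a * e ≤ b * c := by
  by_contra! hlt
  set w := algebraMap R K b + S.i * algebraMap R K e
  have hre : S.re w = b := S.re_mk _ _
  have him : S.im w = e := S.im_mk _ _
  have hw : w ≠ 0 := by rintro h0; rw [h0, map_zero] at hre; exact hb.ne hre
  refine h (-(algebraMap R K a + S.i * algebraMap R K c) * w⁻¹) S.i ?_ (by simp) ?_
  · have hN := S.normSq_pos hw
    rw [S.im_mul, S.re_inv, S.im_inv, hre, him, map_neg, map_neg, S.re_mk, S.im_mk]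
    have : -a * (-e / S.normSq w) + -c * (b / S.normSq w) = (a * e - b * c) / S.normSq w := by
      field_simp; ring
    rw [this]
    exact div_pos (by linarith) hN
  · field_simp
    simp only [w]; ring

/-- With D² = 4ac − b² > 0 and D > 0, the root with imaginary part D/(2c) would lie in the upper
half-plane. -/
theorem quadratic_ineq [IsRealClosed R] {a b c : R} (hc : 0 < c)
    (h : ∀ ξ : K, 0 < S.im ξ → algebraMap R K a + algebraMap R K b * ξ +
      algebraMap R K c * (ξ * ξ) ≠ 0) : 4 * (a * c) ≤ b ^ 2 := by
  by_contra! hlt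
  obtain ⟨D, hD⟩ := IsRealClosed.exists_eq_pow_of_nonneg
    (show 0 ≤ 4 * (a * c) - b ^ 2 by linarith) two_ne_zero
  wlog hD0 : 0 ≤ D generalizing D
  · exact this (-D) (by rw [hD]; ring) (by linarith)
  have hD1 : 0 < D := lt_of_le_of_ne hD0 (by rintro rfl; simp at hD; linarith)
  refine h (algebraMap R K (-b / (2 * c)) + S.i * algebraMap R K (D / (2 * c))) ?_ ?_
  · rw [S.im_mk]; positivity
  · rw [S.ext_iff']
    simp only [map_add S.re, map_add S.im, S.re_mul, S.im_mul, S.re_algebraMap, S.im_algebraMap,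
      S.re_i, S.im_i, map_zero]
    constructor
    · field_simp; linear_combination c * hD
    · field_simp; ring

variable {g : MvPolynomial (Fin 3) R} {d : ℕ} (hd : g.IsHomogeneous d)
  (hg : S.Stable (map (algebraMap R K) g))
  (hpos : ∀ p q, p + q ≤ d → 0 < tcoeff d g p q)
include hd hg hpos

/-- The truncation to a 2 × 2 box is a bilinear form times ξ^p σ^q. The box weights have the same
product on both sides and cancel. -/
theorem tcoeff_mul_le {p q : ℕ} (hpq : p + q + 2 ≤ d) :
    tcoeff d g p q * tcoeff d g (p + 1) (q + 1) ≤
      tcoeff d g (p + 1) q * tcoeff d g p (q + 1) := by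
  have w0 : (0 : R) < boxWeight p (p + 1) d p :=
    Nat.cast_pos.2 (boxWeight_pos d le_rfl (Nat.le_succ p))
  have w1 : (0 : R) < boxWeight p (p + 1) d (p + 1) :=
    Nat.cast_pos.2 (boxWeight_pos d (Nat.le_succ p) le_rfl)
  have v0 : (0 : R) < boxWeight q (q + 1) d q :=
    Nat.cast_pos.2 (boxWeight_pos d le_rfl (Nat.le_succ q))
  have v1 : (0 : R) < boxWeight q (q + 1) d (q + 1) :=
    Nat.cast_pos.2 (boxWeight_pos d (Nat.le_succ q) le_rfl)
  have a1 := hpos (p + 1) q (by omega)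
  have h := S.bilinear_ineq (K := K)
    (a := boxWeight p (p + 1) d p * boxWeight q (q + 1) d q * tcoeff d g p q)
    (b := boxWeight p (p + 1) d (p + 1) * boxWeight q (q + 1) d q * tcoeff d g (p + 1) q)
    (c := boxWeight p (p + 1) d p * boxWeight q (q + 1) d (q + 1) * tcoeff d g p (q + 1))
    (e := boxWeight p (p + 1) d (p + 1) * boxWeight q (q + 1) d (q + 1) *
      tcoeff d g (p + 1) (q + 1)) (by positivity) (by
    intro ξ σ hξ hσ h0
    refine S.eval_wt_box_ne_zero hd hg (m := 1) (n := 1)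
      (hpos p q (by omega)).ne' hξ hσ ?_
    simp only [Finset.sum_range_succ, Finset.sum_range_zero, zero_add, add_zero]
    linear_combination (ξ ^ p * σ ^ q) * h0)
  have hW : (0 : R) < boxWeight p (p + 1) d p * boxWeight p (p + 1) d (p + 1) *
    (boxWeight q (q + 1) d q * boxWeight q (q + 1) d (q + 1)) := by positivity
  refine le_of_mul_le_mul_left ?_ hW
  linarith

/-- Newton's inequality from the truncation to a 3 × 1 box, which is quadratic in ξ. The constant is
kept a natural number so that its valuation is nonnegative. -/
theorem tcoeff_newton [IsRealClosed R] {p q : ℕ} (hpq : p + 2 + q ≤ d) :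
    tcoeff d g p q * tcoeff d g (p + 2) q ≤
      ((boxWeight p (p + 2) d (p + 1) ^ 2 : ℕ) : R) * tcoeff d g (p + 1) q ^ 2 := by
  have w0 : (1 : R) ≤ boxWeight p (p + 2) d p :=
    Nat.one_le_cast.2 (boxWeight_pos d le_rfl (by omega))
  have w2 : (1 : R) ≤ boxWeight p (p + 2) d (p + 2) :=
    Nat.one_le_cast.2 (boxWeight_pos d (by omega) le_rfl)
  have v0 : (0 : R) < boxWeight q (q + 0) d q :=
    Nat.cast_pos.2 (boxWeight_pos d le_rfl le_rfl)
  have a0 := hpos p q (by omega)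
  have a2 := hpos (p + 2) q (by omega)
  have h := S.quadratic_ineq (K := K)
    (a := boxWeight p (p + 2) d p * boxWeight q (q + 0) d q * tcoeff d g p q)
    (b := boxWeight p (p + 2) d (p + 1) * boxWeight q (q + 0) d q * tcoeff d g (p + 1) q)
    (c := boxWeight p (p + 2) d (p + 2) * boxWeight q (q + 0) d q * tcoeff d g (p + 2) q)
    (by positivity) (by
    intro ξ hξ h0
    refine S.eval_wt_box_ne_zero hd hg (m := 2) (n := 0)
      a0.ne' hξ (σ := S.i) (by simp) ?_
    simp only [Finset.sum_range_succ, Finset.sum_range_zero, zero_add, add_zero]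
    linear_combination (ξ ^ p * S.i ^ q) * h0)
  push_cast
  have hW : (0 : R) < boxWeight q (q + 0) d q ^ 2 := by positivity
  have h1 : (1 : R) ≤ boxWeight p (p + 2) d p * boxWeight p (p + 2) d (p + 2) := by nlinarith
  have h2 := mul_pos a0 a2
  have h3 : 4 * (boxWeight p (p + 2) d p * boxWeight p (p + 2) d (p + 2) *
      (tcoeff d g p q * tcoeff d g (p + 2) q)) ≤
      boxWeight p (p + 2) d (p + 1) ^ 2 * tcoeff d g (p + 1) q ^ 2 := by
    refine le_of_mul_le_mul_left ?_ hW
    linarith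
  nlinarith

end CartesianCoords

/-! ### Full supports and perturbation -/

/-- `P` is homogeneous of degree `n`, and all coefficients in degree `n` are positive. -/
def FullPos {A ι : Type*} [CommSemiring A] [LT A] (n : ℕ) (P : MvPolynomial ι A) : Prop :=
  P.IsHomogeneous n ∧ ∀ u : ι →₀ ℕ, u.degree = n → 0 < coeff u P

section FullPos

variable {R ι : Type*} [Field R] [LinearOrder R] [IsStrictOrderedRing R]

theorem FullPos.coeff_nonneg {n : ℕ} {P : MvPolynomial ι R} (hP : FullPos n P) (u : ι →₀ ℕ) :
    0 ≤ coeff u P := by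
  by_cases h : u.degree = n
  · exact (hP.2 u h).le
  · rw [hP.1.coeff_eq_zero h]

theorem fullPos_one : FullPos 0 (1 : MvPolynomial ι R) := by
  refine ⟨isHomogeneous_one _ _, fun u hu => ?_⟩
  rw [Finsupp.degree_eq_zero_iff] at hu
  rw [hu]; simp

theorem FullPos.mul_linear {n : ℕ} {P L : MvPolynomial ι R} (hP : FullPos n P)
    (hL : FullPos 1 L) : FullPos (n + 1) (P * L) := by
  classical
  refine ⟨hP.1.mul hL.1, fun u hu => ?_⟩
  rw [coeff_mul]
  refine Finset.sum_pos' (fun ab _ => mul_nonneg (hP.coeff_nonneg _) (hL.coeff_nonneg _)) ?_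
  have hu0 : u ≠ 0 := by rintro rfl; simp at hu
  obtain ⟨k, hk⟩ := Finsupp.ne_iff.1 hu0
  have hle : Finsupp.single k 1 ≤ u := by
    rw [Finsupp.single_le_iff]; exact Nat.one_le_iff_ne_zero.2 hk
  have hadd : u - Finsupp.single k 1 + Finsupp.single k 1 = u := tsub_add_cancel_of_le hle
  refine ⟨(u - Finsupp.single k 1, Finsupp.single k 1), Finset.HasAntidiagonal.mem_antidiagonal.2 hadd, ?_⟩
  refine mul_pos (hP.2 _ ?_) (hL.2 _ (by simp))
  have h := congr_arg Finsupp.degree hadd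
  rw [map_add, Finsupp.degree_single, hu] at h
  exact Nat.succ_injective h

theorem FullPos.mul_linear_pow {n : ℕ} {P L : MvPolynomial ι R} (hP : FullPos n P)
    (hL : FullPos 1 L) (m : ℕ) : FullPos (n + m) (P * L ^ m) := by
  induction m with
  | zero => simpa using hP
  | succ m ih => rw [pow_succ, ← mul_assoc, ← add_assoc]; exact ih.mul_linear hL

theorem fullPos_prod [Fintype ι] (L : ι → MvPolynomial ι R) (hL : ∀ k, FullPos 1 (L k))
    (u : ι → ℕ) (s : Finset ι) : FullPos (∑ k ∈ s, u k) (∏ k ∈ s, L k ^ u k) := by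
  classical
  induction s using Finset.induction_on with
  | empty => simpa using fullPos_one
  | insert k s hk ih =>
    rw [Finset.sum_insert hk, Finset.prod_insert hk, add_comm, mul_comm]
    exact ih.mul_linear_pow (hL k) (u k)

variable [Fintype ι]

/-- The linear substitution `x_k ↦ x_k + ε ∑ x_l`. -/
def perturb {A : Type*} [CommRing A] (ε : A) (g : MvPolynomial ι R) (φ : R →+* A) :
    MvPolynomial ι A :=
  eval₂ (C.comp φ) (fun k => X k + C ε * ∑ l, X l) g

theorem isHomogeneous_perturb {A : Type*} [CommRing A] (ε : A) {g : MvPolynomial ι R}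
    (φ : R →+* A) {d : ℕ} (hd : g.IsHomogeneous d) : (perturb ε g φ).IsHomogeneous d := by
  have h := hd.eval₂ (C.comp φ) (fun k => X k + C ε * ∑ l, X l)
    (n := 1) (fun r => isHomogeneous_C _ _) (fun k => (isHomogeneous_X _ k).add
      ((IsHomogeneous.sum _ _ 1 fun l _ => isHomogeneous_X _ l).C_mul ε))
  simpa [perturb] using h

theorem map_perturb {A B : Type*} [CommRing A] [CommRing B] (ε : A) (g : MvPolynomial ι R)
    (φ : R →+* A) (ψ : A →+* B) : map ψ (perturb ε g φ) = perturb (ψ ε) g (ψ.comp φ) := by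
  rw [perturb, perturb, ← coe_eval₂Hom, ← coe_eval₂Hom, ← RingHom.comp_apply]
  refine DFunLike.congr_fun (MvPolynomial.ringHom_ext ?_ ?_) g
  · intro r; simp
  · intro k; simp

theorem perturb_zero (g : MvPolynomial ι R) : perturb 0 g (RingHom.id R) = g := by
  simp [perturb, eval₂_eta]

theorem eval_perturb {A : Type*} [CommRing A] (ε : A) (g : MvPolynomial ι R) (φ : R →+* A)
    (z : ι → A) : eval z (perturb ε g φ) = eval (fun k => z k + ε * ∑ l, z l) (map φ g) := by
  rw [perturb, ← coe_eval₂Hom, ← RingHom.comp_apply, ← RingHom.comp_apply]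
  refine DFunLike.congr_fun (MvPolynomial.ringHom_ext ?_ ?_) g
  · intro r; simp
  · intro k; simp

/-- Every form x_k + ε Σ x_l has all coefficients positive, and products of such forms have full
positive support. Positivity is what later permits quotients of coefficients. -/
theorem fullPos_perturb [DecidableEq ι] {ε : R} (hε : 0 < ε) {g : MvPolynomial ι R} {d : ℕ}
    (hd : g.IsHomogeneous d) (hg : ∀ u, 0 ≤ coeff u g) (hg0 : g ≠ 0) :
    FullPos d (perturb ε g (RingHom.id R)) := by
  refine ⟨isHomogeneous_perturb ε _ hd, fun u hu => ?_⟩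
  have hL : ∀ k : ι, FullPos 1 (X k + C ε * ∑ l, X l : MvPolynomial ι R) := by
    intro k
    refine ⟨(isHomogeneous_X _ k).add
      ((IsHomogeneous.sum _ _ 1 fun l _ => isHomogeneous_X _ l).C_mul ε), fun v hv => ?_⟩
    obtain ⟨l, rfl⟩ : ∃ l, v = Finsupp.single l 1 := by
      have hv0 : v ≠ 0 := by rintro rfl; simp at hv
      obtain ⟨l, hl⟩ := Finsupp.ne_iff.1 hv0
      have hle : Finsupp.single l 1 ≤ v := by
        rw [Finsupp.single_le_iff]; exact Nat.one_le_iff_ne_zero.2 hl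
      refine ⟨l, ?_⟩
      have h := tsub_add_cancel_of_le hle
      have h' := congr_arg Finsupp.degree h
      rw [map_add, Finsupp.degree_single, hv] at h'
      have : (v - Finsupp.single l 1) = 0 := by
        rw [← Finsupp.degree_eq_zero_iff]; omega
      rw [this, zero_add] at h
      exact h.symm
    have h1 : coeff (Finsupp.single l 1) (∑ l : ι, (X l : MvPolynomial ι R)) = 1 := by
      rw [coeff_sum, Finset.sum_eq_single l]
      · simp
      · intro b _ hb; rw [coeff_X, if_neg]; simpa [Finsupp.single_left_inj] using hb
      · simp
    rw [coeff_add, coeff_C_mul, h1, mul_one, coeff_X]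
    split_ifs <;> positivity
  rw [perturb, eval₂_eq', coeff_sum]
  have hterm : ∀ v ∈ g.support, 0 < coeff u ((C.comp (RingHom.id R)) (coeff v g) *
      ∏ k, (X k + C ε * ∑ l, X l : MvPolynomial ι R) ^ v k) := by
    intro v hv
    rw [RingHom.comp_id, coeff_C_mul]
    refine mul_pos (lt_of_le_of_ne (hg v) (mem_support_iff.1 hv).symm)
      ((fullPos_prod _ hL v Finset.univ).2 u ?_)
    rw [hu, sum_eq_of_mem_support hd hv]
  exact Finset.sum_pos hterm (support_nonempty.2 hg0)

end FullPos

/-- A polynomial that is nonnegative at all positive points is nonnegative at `0`. -/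
theorem eval_zero_nonneg {R : Type*} [Field R] [LinearOrder R] [IsStrictOrderedRing R]
    (p : Polynomial R) (h : ∀ ε, 0 < ε → 0 ≤ p.eval ε) : 0 ≤ p.eval 0 := by
  by_contra! hlt
  -- B is the sum of the absolute values of the coefficients of (p − p(0))/X.
  obtain ⟨B, hB⟩ : ∃ B, ∀ ε : R, 0 < ε → ε ≤ 1 → p.eval ε ≤ p.eval 0 + ε * B := by
    have hp := p.divX_mul_X_add
    refine ⟨∑ k ∈ p.divX.support, |p.divX.coeff k|, fun ε h0 h1 => ?_⟩
    have h2 : p.eval ε = p.eval 0 + ε * p.divX.eval ε := by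
      conv_lhs => rw [← hp]
      rw [← Polynomial.coeff_zero_eq_eval_zero]
      simp; ring
    rw [h2]
    gcongr
    rw [Polynomial.eval_eq_sum, Polynomial.sum]
    refine Finset.sum_le_sum fun k _ => ?_
    calc p.divX.coeff k * ε ^ k ≤ |p.divX.coeff k| * ε ^ k :=
          mul_le_mul_of_nonneg_right (le_abs_self _) (by positivity)
      _ ≤ |p.divX.coeff k| * 1 := by
          gcongr
          exact pow_le_one₀ h0.le h1
      _ = _ := mul_one _
  have hB1 := hB 1 one_pos le_rfl
  have := h 1 one_pos
  have hBpos : 0 < B := by linarith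
  set c := -p.eval 0 with hc
  have hc0 : 0 < c := by linarith
  set ε := min 1 (c / (2 * B))
  have hε0 : 0 < ε := lt_min one_pos (by positivity)
  have h3 := hB ε hε0 (min_le_left _ _)
  have h4 := h ε hε0
  have h5 : ε * B ≤ c / 2 := by
    calc ε * B ≤ c / (2 * B) * B := by gcongr; exact min_le_right _ _
      _ = c / 2 := by field_simp
  linarith

/-! ### The exchange inequality for ternary forms. -/

namespace CartesianCoords

variable {R K : Type*} [Field R] [LinearOrder R] [IsStrictOrderedRing R]
  [Field K] [Algebra R K] (S : CartesianCoords R K)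

theorem stable_perturb {ι : Type*} [Fintype ι] {ε : R} (hε : 0 < ε) {g : MvPolynomial ι R}
    (hg : S.Stable (map (algebraMap R K) g)) :
    S.Stable (map (algebraMap R K) (perturb ε g (RingHom.id R))) := fun z hz => by
  rw [map_perturb, eval_perturb, RingHom.comp_id]
  refine hg _ fun k => ?_
  have : 0 ≤ ε * ∑ l, S.im (z l) := mul_nonneg hε.le (Finset.sum_nonneg fun l _ => (hz l).le)
  simp only [map_add, S.im_mul, S.re_algebraMap, S.im_algebraMap, zero_mul, add_zero, map_sum]
  linarith [hz k]

variable [IsAlgClosed K]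

section Chain

variable {g : MvPolynomial (Fin 3) R} {d : ℕ} (hd : g.IsHomogeneous d)
  (hg : S.Stable (map (algebraMap R K) g))
  (hpos : ∀ p q, p + q ≤ d → 0 < tcoeff d g p q)
include hd hg hpos

theorem tcoeff_ratio_right {p q m : ℕ} (hpq : p + 1 + (q + m) ≤ d) :
    tcoeff d g (p + 1) (q + m) / tcoeff d g p (q + m) ≤
      tcoeff d g (p + 1) q / tcoeff d g p q := by
  induction m with
  | zero => exact le_rfl
  | succ m ih =>
    refine le_trans ?_ (ih (by omega))
    rw [div_le_div_iff₀ (hpos _ _ (by omega)) (hpos _ _ (by omega)), mul_comm, ← add_assoc]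
    exact S.tcoeff_mul_le hd hg hpos (by omega)

end Chain

/-- Iterates `tcoeff_newton`. The constant is fixed before g, since it will be applied to a whole
family of rescaled forms. -/
theorem tcoeff_ratio_left [IsRealClosed R] (d p m : ℕ) : ∃ c : ℕ, ∀ g : MvPolynomial (Fin 3) R,
    g.IsHomogeneous d → S.Stable (map (algebraMap R K) g) →
    (∀ p q, p + q ≤ d → 0 < tcoeff d g p q) → ∀ q, p + m + 1 + q ≤ d →
    tcoeff d g (p + m + 1) q / tcoeff d g (p + m) q ≤
      c * (tcoeff d g (p + 1) q / tcoeff d g p q) := by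
  induction m with
  | zero => exact ⟨1, fun g _ _ _ q _ => by simp⟩
  | succ m ih =>
    obtain ⟨c, hc⟩ := ih
    refine ⟨boxWeight (p + m) (p + m + 2) d (p + m + 1) ^ 2 * c,
      fun g hd hg hpos q hq => ?_⟩
    have h1 := hc g hd hg hpos q (by omega)
    have h2 := S.tcoeff_newton hd hg hpos (p := p + m) (q := q) (by omega)
    have a0 := hpos (p + m) q (by omega)
    have a1 := hpos (p + m + 1) q (by omega)
    have h3 : tcoeff d g (p + m + 2) q / tcoeff d g (p + m + 1) q ≤
        ((boxWeight (p + m) (p + m + 2) d (p + m + 1) ^ 2 : ℕ) : R) *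
        (tcoeff d g (p + m + 1) q / tcoeff d g (p + m) q) := by
      rw [← mul_div_assoc, div_le_div_iff₀ a1 a0]
      linarith
    refine h3.trans ?_
    rw [Nat.cast_mul, mul_assoc]
    exact mul_le_mul_of_nonneg_left h1 (Nat.cast_nonneg _)

/-- The exchange inequality for stable ternary forms. -/
theorem tcoeff_exchange [IsRealClosed R] (d p q m n : ℕ) (hd : p + m + 1 + (q + n) ≤ d) :
    ∃ c : ℕ, ∀ g : MvPolynomial (Fin 3) R, g.IsHomogeneous d →
      S.Stable (map (algebraMap R K) g) → (∀ u, 0 ≤ coeff u g) →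
      tcoeff d g (p + m + 1) (q + n) * tcoeff d g p q ≤
        c * (tcoeff d g (p + m) (q + n) * tcoeff d g (p + 1) q) := by
  obtain ⟨c, hc⟩ := S.tcoeff_ratio_left d p m
  refine ⟨c, fun g hgd hg hnn => ?_⟩
  rcases eq_or_ne g 0 with rfl | hg0
  · simp [tcoeff]
  -- With ε a formal variable the inequality is one between polynomials in ε. It is proved by
  -- quotients for ε > 0 and carried to ε = 0, where coefficients may vanish, by `eval_zero_nonneg`.
  let P : MvPolynomial (Fin 3) (Polynomial R) := perturb Polynomial.X g Polynomial.C
  have hP : ∀ ε : R, map (Polynomial.evalRingHom ε) P = perturb ε g (RingHom.id R) := by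
    intro ε
    rw [map_perturb]
    congr 1
    · simp
    · ext; simp
  have hPc : ∀ (ε : R) (a b : ℕ), (tcoeff d P a b).eval ε =
      tcoeff d (perturb ε g (RingHom.id R)) a b := by
    intro ε a b
    rw [← hP, tcoeff, tcoeff, coeff_map]; rfl
  have hP0 : ∀ a b, (tcoeff d P a b).eval 0 = tcoeff d g a b := fun a b => by
    rw [hPc, perturb_zero]
  have key := eval_zero_nonneg ((c : Polynomial R) *
    (tcoeff d P (p + m) (q + n) * tcoeff d P (p + 1) q) -
    tcoeff d P (p + m + 1) (q + n) * tcoeff d P p q) fun ε hε => by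
      simp only [Polynomial.eval_sub, Polynomial.eval_mul, Polynomial.eval_natCast, hPc]
      have hfull := fullPos_perturb hε hgd hnn hg0
      have hst := S.stable_perturb hε hg
      set G := perturb ε g (RingHom.id R)
      have hpos : ∀ p q, p + q ≤ d → 0 < tcoeff d G p q := fun p q hpq =>
        hfull.2 _ (by rw [degree_expo]; omega)
      have h1 := S.tcoeff_ratio_right hfull.1 hst hpos (p := p + m) (q := q) (m := n) (by omega)
      have h2 := hc G hfull.1 hst hpos q (by omega)
      have h3 := h1.trans h2
      rw [← mul_div_assoc, div_le_div_iff₀ (hpos _ _ (by omega)) (hpos _ _ (by omega))] at h3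
      linarith
  simp only [Polynomial.eval_sub, Polynomial.eval_mul, Polynomial.eval_natCast, hP0] at key
  linarith

end CartesianCoords

/-! ### Auxiliary facts on finite sums -/

theorem sum_le_sum_of_cover {R α β : Type*} [Field R] [LinearOrder R] [IsStrictOrderedRing R]
    (s : Finset α) (t : Finset β) (g : α → R) (hg : ∀ a, 0 ≤ g a) (φ : β → α)
    (h : ∀ a ∈ s, ∃ b ∈ t, φ b = a) : ∑ a ∈ s, g a ≤ ∑ b ∈ t, g (φ b) := by
  classical
  have hsub : s ⊆ t.image φ := fun a ha => Finset.mem_image.2 (h a ha)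
  refine (Finset.sum_le_sum_of_subset_of_nonneg hsub fun a _ _ => hg a).trans ?_
  rw [← Finset.sum_fiberwise_of_maps_to (s := t) (t := t.image φ) (g := φ)
    fun b hb => Finset.mem_image_of_mem _ hb]
  refine Finset.sum_le_sum fun a ha => ?_
  obtain ⟨b, hb, rfl⟩ := Finset.mem_image.1 ha
  exact Finset.single_le_sum (f := fun b => g (φ b)) (fun b _ => hg _)
    (Finset.mem_filter.2 ⟨hb, rfl⟩)

theorem eq_of_sum_eq {ι : Type*} {s : Finset ι} {a b : ι → ℕ} (h : ∀ k ∈ s, a k ≤ b k)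
    (hs : ∑ k ∈ s, b k = ∑ k ∈ s, a k) : ∀ k ∈ s, b k = a k := fun k hk =>
  ((Finset.sum_eq_sum_iff_of_le h).1 hs.symm k hk).symm

theorem exists_of_sum_eq_add_one {ι : Type*} [DecidableEq ι] {s : Finset ι} {a b : ι → ℕ}
    (h : ∀ k ∈ s, a k ≤ b k) (hs : ∑ k ∈ s, b k = ∑ k ∈ s, a k + 1) :
    ∃ j ∈ s, b j = a j + 1 ∧ ∀ k ∈ s, k ≠ j → b k = a k := by
  obtain ⟨j, hj, hlt⟩ : ∃ j ∈ s, a j < b j := by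
    by_contra! hcon
    have := Finset.sum_le_sum hcon
    omega
  have e1 := Finset.add_sum_erase s a hj
  have e2 := Finset.add_sum_erase s b hj
  have hle : ∀ k ∈ s.erase j, a k ≤ b k := fun k hk => h k (Finset.mem_of_mem_erase hk)
  have h3 := Finset.sum_le_sum hle
  refine ⟨j, hj, by omega, fun k hk hkj => ?_⟩
  exact eq_of_sum_eq hle (by omega) k (Finset.mem_erase.2 ⟨hkj, hk⟩)

theorem exists_balance {R : Type*} [Field R] [LinearOrder R] [IsStrictOrderedRing R] {p q Θ : R}
    (hp : 0 ≤ p) (hq : 0 ≤ q) (hΘ : 0 < Θ) (h : p * q ≤ Θ) :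
    ∃ t, 0 < t ∧ p * t ≤ 1 ∧ q * t⁻¹ ≤ Θ := by
  rcases hq.eq_or_lt with rfl | hq
  · rcases hp.eq_or_lt with rfl | hp
    · exact ⟨1, one_pos, by simp, by simpa using hΘ.le⟩
    · exact ⟨p⁻¹, by positivity, by rw [mul_inv_cancel₀ hp.ne'], by simpa using hΘ.le⟩
  · refine ⟨q / Θ, by positivity, ?_, ?_⟩
    · rw [← mul_div_assoc, div_le_one hΘ]; exact h
    · rw [inv_div, mul_div_cancel₀ _ hq.ne']

/-- If `Θ ≤ c (∑ p_j η_j) (∑ q_j / η_j)` for all positive `η`, then `Θ` is bounded by a multiple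
of some `p_j q_j`. -/
theorem exists_le_mul_of_forall {R ι : Type*} [Field R] [LinearOrder R] [IsStrictOrderedRing R]
    (J : Finset ι) (p q : ι → R) (hp : ∀ j, 0 ≤ p j) (hq : ∀ j, 0 ≤ q j) {Θ : R} (hΘ : 0 < Θ)
    (c : ℕ) (i : ι) (hi : i ∉ J) (h : ∀ η : ι → R, (∀ k, 0 < η k) → η i = 1 →
      Θ ≤ c * ((∑ j ∈ J, p j * η j) * ∑ j ∈ J, q j * (η j)⁻¹)) :
    ∃ j ∈ J, Θ ≤ ((c * J.card ^ 2 + 1 : ℕ) : R) * (p j * q j) := by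
  classical
  by_contra! hcon
  -- M − 1 = c|J|². If every p_j q_j were below Θ/M, one could balance p_j η_j ≤ 1 against q_j/η_j ≤
  -- Θ/M, and the right side would be at most (M − 1)Θ/M < Θ.
  set M : R := ((c * J.card ^ 2 + 1 : ℕ) : R) with hM
  have hM0 : 0 < M := Nat.cast_pos.2 (Nat.succ_pos _)
  have hex : ∀ j, ∃ t, 0 < t ∧ (j = i → t = 1) ∧ (j ∈ J → p j * t ≤ 1 ∧ q j * t⁻¹ ≤ Θ / M) := by
    intro j
    by_cases hj : j ∈ J
    · obtain ⟨t, h1, h2, h3⟩ := exists_balance (hp j) (hq j) (div_pos hΘ hM0)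
        (by rw [le_div_iff₀ hM0, mul_comm]; exact (hcon j hj).le)
      exact ⟨t, h1, fun hji => absurd (hji ▸ hj) hi, fun _ => ⟨h2, h3⟩⟩
    · exact ⟨1, one_pos, fun _ => rfl, fun h => absurd h hj⟩
  choose η h1 h2 h3 using hex
  have h4 := h η h1 (h2 i rfl)
  have h5 : ∑ j ∈ J, p j * η j ≤ J.card := by
    have := Finset.sum_le_card_nsmul J (fun j => p j * η j) 1 fun j hj => (h3 j hj).1
    simpa using this
  have h6 : ∑ j ∈ J, q j * (η j)⁻¹ ≤ J.card * (Θ / M) := by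
    have := Finset.sum_le_card_nsmul J (fun j => q j * (η j)⁻¹) (Θ / M) fun j hj => (h3 j hj).2
    simpa using this
  have h7 : 0 ≤ ∑ j ∈ J, q j * (η j)⁻¹ :=
    Finset.sum_nonneg fun j _ => mul_nonneg (hq j) (inv_pos.2 (h1 j)).le
  have h8 : (∑ j ∈ J, p j * η j) * ∑ j ∈ J, q j * (η j)⁻¹ ≤ J.card * (J.card * (Θ / M)) :=
    mul_le_mul h5 h6 h7 (Nat.cast_nonneg _)
  have h9 : Θ ≤ c * (J.card * (J.card * (Θ / M))) :=
    h4.trans (mul_le_mul_of_nonneg_left h8 (Nat.cast_nonneg _))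
  have h10 : (c : R) * (J.card * (J.card * (Θ / M))) = (M - 1) * (Θ / M) := by
    rw [hM]; push_cast; ring
  have h11 : (M - 1) * (Θ / M) = Θ - Θ / M := by field_simp
  have h12 : 0 < Θ / M := div_pos hΘ hM0
  linarith

/-! ### Scaling and identifying variables -/

section Rename

variable {R ι : Type*} [Field R] [LinearOrder R] [IsStrictOrderedRing R] [Fintype ι]

/-- The weight `η^u`. -/
def powWeight (η : ι → R) (u : ι →₀ ℕ) : R := ∏ k, η k ^ u k

theorem powWeight_pos {η : ι → R} (hη : ∀ k, 0 < η k) (u : ι →₀ ℕ) : 0 < powWeight η u :=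
  Finset.prod_pos fun k _ => pow_pos (hη k) _

theorem powWeight_add_single (η : ι → R) (u : ι →₀ ℕ) (j : ι) :
    powWeight η (u + Finsupp.single j 1) = powWeight η u * η j := by
  classical
  simp only [powWeight, Finsupp.add_apply, pow_add, Finset.prod_mul_distrib]
  congr 1
  rw [Finset.prod_eq_single j]
  · simp
  · intro k _ hk; simp [hk.symm]
  · simp

theorem mapDomain_apply_eq_sum [DecidableEq ι] (τ : ι → Fin 3) (u : ι →₀ ℕ) (a : Fin 3) :
    u.mapDomain τ a = ∑ k with τ k = a, u k := by
  rw [Finsupp.mapDomain, Finsupp.sum_fintype _ _ (by simp), Finsupp.finsetSum_apply,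
    Finset.sum_filter]
  exact Finset.sum_congr rfl fun k _ => Finsupp.single_apply

theorem coeff_rename_eq_sum (τ : ι → Fin 3) (F : MvPolynomial ι R) (v : Fin 3 →₀ ℕ) :
    coeff v (rename τ F) = ∑ u ∈ F.support with u.mapDomain τ = v, coeff u F := by
  classical
  conv_lhs => rw [F.as_sum]
  rw [map_sum, coeff_sum, Finset.sum_filter]
  refine Finset.sum_congr rfl fun u _ => ?_
  rw [rename_monomial, coeff_monomial]

theorem stable_rename_wt {K : Type*} [Field K] [Algebra R K] (S : CartesianCoords R K)
    {η : ι → R} (hη : ∀ k, 0 < η k) (τ : ι → Fin 3) {F : MvPolynomial ι R}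
    (hF : S.Stable (map (algebraMap R K) F)) :
    S.Stable (map (algebraMap R K) (rename τ (wt (powWeight η) F))) := fun z hz => by
  rw [map_rename, eval_rename]
  have h : eval (z ∘ τ) (map (algebraMap R K) (wt (powWeight η) F)) =
      eval (fun k => algebraMap R K (η k) * z (τ k)) (map (algebraMap R K) F) := by
    have e : map (algebraMap R K) (wt (powWeight η) F)
        = wt (powWeight η) (map (algebraMap R K) F) := by
      ext u
      rw [coeff_map, coeff_wt, coeff_wt, coeff_map, map_mul]; rfl
    rw [e, eval_wt, eval_eq']
    refine Finset.sum_congr rfl fun u _ => ?_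
    simp only [powWeight, map_prod, map_pow, mul_pow, Finset.prod_mul_distrib,
      Function.comp_apply]
    ring
  rw [h]
  refine hF _ fun k => ?_
  simp only [S.im_mul, S.re_algebraMap, S.im_algebraMap, zero_mul, add_zero]
  exact mul_pos (hη k) (hz _)

end Rename

/-! ### The exchange inequality in any number of variables. -/

namespace CartesianCoords

variable {R K ι : Type*} [Field R] [LinearOrder R] [IsStrictOrderedRing R] [IsRealClosed R]
  [Field K] [Algebra R K] (S : CartesianCoords R K) [IsAlgClosed K] [Fintype ι] [DecidableEq ι]

/-- The variables are merged into three: i alone, the others with y_k < x_k, and the others with x_k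
≤ y_k. Within the box, degree counts show that the monomials merging to the exchanged ternary
exponents are exactly of the form x − e_i + e_j or y + e_i − e_j with j in J. The ternary inequality
thus bounds a_x a_y by a product of two sums over j, and scaling isolates a common j. -/
theorem exchange_of_box {F : MvPolynomial ι R} {d : ℕ} (hd : F.IsHomogeneous d)
    (hF : S.Stable (map (algebraMap R K) F)) (hnn : ∀ u, 0 ≤ coeff u F) {x y : ι →₀ ℕ}
    (hx : x ∈ F.support) (hy : y ∈ F.support)
    (hbox : ∀ u ∈ F.support, ∀ k, min (x k) (y k) ≤ u k ∧ u k ≤ max (x k) (y k))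
    {i : ι} (hi : y i < x i) :
    ∃ j, x j < y j ∧ ∃ c : ℕ, coeff x F * coeff y F ≤
      c * (coeff (x - Finsupp.single i 1 + Finsupp.single j 1) F *
        coeff (y + Finsupp.single i 1 - Finsupp.single j 1) F) := by
  set τ : ι → Fin 3 := fun k => if k = i then 0 else if y k < x k then 1 else 2 with hτ
  have hτ0 : ∀ k, τ k = 0 ↔ k = i := by
    intro k; simp only [hτ]; split_ifs <;> simp_all
  have hτ1 : ∀ k, τ k = 1 ↔ k ≠ i ∧ y k < x k := by
    intro k; simp only [hτ]; split_ifs <;> simp_all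
  have hτ2 : ∀ k, τ k = 2 ↔ k ≠ i ∧ x k ≤ y k := by
    intro k; simp only [hτ]; split_ifs <;> simp_all
  have hsum0 : ∀ u : ι → ℕ, ∑ k with τ k = 0, u k = u i := by
    intro u; simp only [hτ0, Finset.sum_filter, Finset.sum_ite_eq', Finset.mem_univ, if_true]
  set P : (ι →₀ ℕ) → ℕ := fun u => ∑ k with τ k = 1, u k with hP
  set N : (ι →₀ ℕ) → ℕ := fun u => ∑ k with τ k = 2, u k with hN
  have htot : ∀ u ∈ F.support, u i + P u + N u = d := by
    intro u hu
    rw [← sum_eq_of_mem_support hd hu, ← Finset.sum_fiberwise (s := Finset.univ) τ,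
      Fin.sum_univ_three, hsum0]
  have hPyx : P y ≤ P x := Finset.sum_le_sum fun k hk =>
    ((hτ1 k).1 (Finset.mem_filter.1 hk).2).2.le
  obtain ⟨m, hm⟩ : ∃ m, x i = y i + m + 1 := ⟨x i - y i - 1, by omega⟩
  obtain ⟨n, hn⟩ : ∃ n, P x = P y + n := ⟨P x - P y, by omega⟩
  have htx := htot x hx
  obtain ⟨c, hc⟩ := S.tcoeff_exchange d (y i) (P y) m n (by omega)

  set J : Finset ι := {j | x j < y j} with hJ
  have hiJ : i ∉ J := by simp [hJ]; omega
  have hJlt : ∀ j ∈ J, x j < y j := fun j hj => (Finset.mem_filter.1 hj).2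
  set px : ι → (ι →₀ ℕ) := fun j => x - Finsupp.single i 1 + Finsupp.single j 1 with hpx
  set qy : ι → (ι →₀ ℕ) := fun j => y + Finsupp.single i 1 - Finsupp.single j 1 with hqy
  have hΘ : 0 < coeff x F * coeff y F :=
    mul_pos (lt_of_le_of_ne (hnn x) (mem_support_iff.1 hx).symm)
      (lt_of_le_of_ne (hnn y) (mem_support_iff.1 hy).symm)
  -- On the second group u ≤ x, so equal sums force u = x there. On the third u ≥ x, so the unit of
  -- degree lost at i reappears at a single j.
  have hcover1 : ∀ u ∈ F.support, u i = y i + m → P u = P x → ∃ j ∈ J, px j = u := by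
    intro u hu h0 h1
    have htu := htot u hu
    have hPk : ∀ k, τ k = 1 → u k = x k := fun k hk => by
      refine (eq_of_sum_eq (s := {k | τ k = 1}) (a := u) (b := x) (fun l hl => ?_) h1.symm k
        (by simp [hk])).symm
      have := (hbox u hu l).2
      have := ((hτ1 l).1 (Finset.mem_filter.1 hl).2).2
      omega
    obtain ⟨j, hj, hj1, hj2⟩ := exists_of_sum_eq_add_one (s := {k | τ k = 2}) (a := x) (b := u)
      (fun l hl => by
        have := (hbox u hu l).1
        have := ((hτ2 l).1 (Finset.mem_filter.1 hl).2).2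
        omega) (by change N u = N x + 1; omega)
    have hj' := (hτ2 j).1 (Finset.mem_filter.1 hj).2
    refine ⟨j, ?_, ?_⟩
    · have := (hbox u hu j).2
      simp only [hJ, Finset.mem_filter, Finset.mem_univ, true_and]
      omega
    · ext k
      simp only [hpx, Finsupp.add_apply, Finsupp.tsub_apply, Finsupp.single_apply]
      by_cases hki : k = i
      · subst hki
        rw [if_pos rfl, if_neg hj'.1]; omega
      · rw [if_neg (Ne.symm hki)]
        by_cases hkj : k = j
        · subst hkj; rw [if_pos rfl]; omega
        · rw [if_neg (Ne.symm hkj)]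
          by_cases hlt : y k < x k
          · rw [hPk k ((hτ1 k).2 ⟨hki, hlt⟩)]; simp
          · rw [hj2 k (by simp [(hτ2 k).2 ⟨hki, not_lt.1 hlt⟩]) hkj]; simp
  have hcover2 : ∀ u ∈ F.support, u i = y i + 1 → P u = P y → ∃ j ∈ J, qy j = u := by
    intro u hu h0 h1
    have htu := htot u hu
    have hty := htot y hy
    have hPk : ∀ k, τ k = 1 → u k = y k := fun k hk => by
      refine eq_of_sum_eq (s := {k | τ k = 1}) (a := y) (b := u) (fun l hl => ?_) h1 k
        (by simp [hk])
      have := (hbox u hu l).1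
      have := ((hτ1 l).1 (Finset.mem_filter.1 hl).2).2
      omega
    obtain ⟨j, hj, hj1, hj2⟩ := exists_of_sum_eq_add_one (s := {k | τ k = 2}) (a := u) (b := y)
      (fun l hl => by
        have := (hbox u hu l).2
        have := ((hτ2 l).1 (Finset.mem_filter.1 hl).2).2
        omega) (by change N y = N u + 1; omega)
    have hj' := (hτ2 j).1 (Finset.mem_filter.1 hj).2
    refine ⟨j, ?_, ?_⟩
    · have := (hbox u hu j).1
      simp only [hJ, Finset.mem_filter, Finset.mem_univ, true_and]
      omega
    · ext k
      simp only [hqy, Finsupp.add_apply, Finsupp.tsub_apply, Finsupp.single_apply]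
      by_cases hki : k = i
      · subst hki
        rw [if_pos rfl, if_neg hj'.1]; omega
      · rw [if_neg (Ne.symm hki)]
        by_cases hkj : k = j
        · subst hkj; rw [if_pos rfl]; omega
        · rw [if_neg (Ne.symm hkj)]
          by_cases hlt : y k < x k
          · rw [hPk k ((hτ1 k).2 ⟨hki, hlt⟩)]; simp
          · rw [hj2 k (by simp [(hτ2 k).2 ⟨hki, not_lt.1 hlt⟩]) hkj]; simp
  -- As η_i = 1, scaling by η multiplies the coefficients at x − e_i + e_j and y + e_i − e_j by η^x
  -- η_j and η^y / η_j; the factor η^x η^y cancels.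
  have key : ∀ η : ι → R, (∀ k, 0 < η k) → η i = 1 → coeff x F * coeff y F ≤
      c * ((∑ j ∈ J, coeff (px j) F * η j) * ∑ j ∈ J, coeff (qy j) F * (η j)⁻¹) := by
    intro η hη hηi
    set G := wt (powWeight η) F with hG
    have hGc : ∀ u, coeff u G = powWeight η u * coeff u F := fun u => by
      rw [hG, coeff_wt]; rfl
    have hGnn : ∀ u, 0 ≤ coeff u G := fun u => by
      rw [hGc]; exact mul_nonneg (powWeight_pos hη u).le (hnn u)
    have hGsupp : ∀ u, u ∈ G.support → u ∈ F.support := fun u hu => support_wt_subset _ _ hu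
    have hTd : (rename τ G).IsHomogeneous d := (isHomogeneous_wt _ hd).rename_isHomogeneous
    have hT : ∀ a b, tcoeff d (rename τ G) a b =
        ∑ u ∈ G.support with u i = a ∧ P u = b, coeff u G := by
      intro a b
      rw [tcoeff, coeff_rename_eq_sum]
      refine Finset.sum_congr (Finset.filter_congr fun u hu => ?_) fun _ _ => rfl
      have htu := htot u (hGsupp u hu)
      constructor
      · intro h
        have e0 := DFunLike.congr_fun h 0
        have e1 := DFunLike.congr_fun h 1
        rw [mapDomain_apply_eq_sum, hsum0, expo_zero] at e0
        rw [mapDomain_apply_eq_sum, expo_one] at e1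
        exact ⟨e0, e1⟩
      · rintro ⟨rfl, rfl⟩
        ext k
        rw [mapDomain_apply_eq_sum]
        fin_cases k
        · exact hsum0 u
        · rfl
        · change N u = d - u i - P u; omega
    have hTnn : ∀ v, 0 ≤ coeff v (rename τ G) := fun v => by
      rw [coeff_rename_eq_sum]; exact Finset.sum_nonneg fun u _ => hGnn u
    have h0 := hc (rename τ G) hTd (stable_rename_wt S hη τ hF) hTnn
    have hw : ∀ u ∈ F.support, u ∈ G.support := fun u hu => by
      rw [mem_support_iff, hGc]
      exact mul_ne_zero (powWeight_pos hη u).ne' (mem_support_iff.1 hu)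
    have b1 : coeff x G ≤ tcoeff d (rename τ G) (y i + m + 1) (P y + n) := by
      rw [hT]
      exact Finset.single_le_sum (f := fun u => coeff u G) (fun u _ => hGnn u)
        (Finset.mem_filter.2 ⟨hw x hx, hm, hn⟩)
    have b2 : coeff y G ≤ tcoeff d (rename τ G) (y i) (P y) := by
      rw [hT]
      exact Finset.single_le_sum (f := fun u => coeff u G) (fun u _ => hGnn u)
        (Finset.mem_filter.2 ⟨hw y hy, rfl, rfl⟩)
    have b3 : tcoeff d (rename τ G) (y i + m) (P y + n) ≤ ∑ j ∈ J, coeff (px j) G := by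
      rw [hT]
      refine sum_le_sum_of_cover _ J (fun u => coeff u G) hGnn px fun u hu => ?_
      obtain ⟨hu1, hu2, hu3⟩ := Finset.mem_filter.1 hu
      exact hcover1 u (hGsupp u hu1) hu2 (hu3.trans hn.symm)
    have b4 : tcoeff d (rename τ G) (y i + 1) (P y) ≤ ∑ j ∈ J, coeff (qy j) G := by
      rw [hT]
      refine sum_le_sum_of_cover _ J (fun u => coeff u G) hGnn qy fun u hu => ?_
      obtain ⟨hu1, hu2, hu3⟩ := Finset.mem_filter.1 hu
      exact hcover2 u (hGsupp u hu1) hu2 hu3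
    have e3 : ∑ j ∈ J, coeff (px j) G = powWeight η x * ∑ j ∈ J, coeff (px j) F * η j := by
      rw [Finset.mul_sum]
      refine Finset.sum_congr rfl fun j _ => ?_
      have h1 : powWeight η x = powWeight η (x - Finsupp.single i 1) := by
        have hle : Finsupp.single i 1 ≤ x := by rw [Finsupp.single_le_iff]; omega
        conv_lhs => rw [← tsub_add_cancel_of_le hle]
        rw [powWeight_add_single, hηi, mul_one]
      rw [hGc, hpx, powWeight_add_single, h1]; ring
    have e4 : ∑ j ∈ J, coeff (qy j) G = powWeight η y * ∑ j ∈ J, coeff (qy j) F * (η j)⁻¹ := by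
      rw [Finset.mul_sum]
      refine Finset.sum_congr rfl fun j hj => ?_
      have h1 : powWeight η y = powWeight η (qy j) * η j := by
        have hle : Finsupp.single j 1 ≤ y + Finsupp.single i 1 := by
          rw [Finsupp.single_le_iff, Finsupp.add_apply]; have := hJlt j hj; omega
        rw [← powWeight_add_single, hqy, tsub_add_cancel_of_le hle, powWeight_add_single, hηi,
          mul_one]
      have := (hη j).ne'
      rw [hGc, h1]; field_simp
    have hwx := powWeight_pos hη x
    have hwy := powWeight_pos hη y
    have h1 : coeff x G * coeff y G ≤
        c * ((∑ j ∈ J, coeff (px j) G) * ∑ j ∈ J, coeff (qy j) G) :=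
      (mul_le_mul b1 b2 (hGnn y) ((hGnn x).trans b1)).trans (h0.trans
        (mul_le_mul_of_nonneg_left (mul_le_mul b3 b4 (hTnn _) (Finset.sum_nonneg
          fun j _ => hGnn _)) (Nat.cast_nonneg _)))
    rw [e3, e4, hGc, hGc] at h1
    refine le_of_mul_le_mul_left ?_ (mul_pos hwx hwy)
    linarith
  obtain ⟨j, hj, hle⟩ := exists_le_mul_of_forall J (fun j => coeff (px j) F)
    (fun j => coeff (qy j) F) (fun _ => hnn _) (fun _ => hnn _) hΘ c i hiJ key
  exact ⟨j, hJlt j hj, _, hle⟩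

/-- The exchange inequality for the coefficients of a homogeneous stable polynomial. -/
theorem exchange {f : MvPolynomial ι R} {d : ℕ} (hd : f.IsHomogeneous d)
    (hf : S.Stable (map (algebraMap R K) f)) (hnn : ∀ u, 0 ≤ coeff u f) {x y : ι →₀ ℕ}
    (hx : x ∈ f.support) (hy : y ∈ f.support) {i : ι} (hi : y i < x i) :
    ∃ j, x j < y j ∧ ∃ c : ℕ, coeff x f * coeff y f ≤
      c * (coeff (x - Finsupp.single i 1 + Finsupp.single j 1) f *
        coeff (y + Finsupp.single i 1 - Finsupp.single j 1) f) := by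
  -- Weights of the box spanned by x and y. They are at least 1 at x and y, and their values at the
  -- exchanged points are absorbed into the constant.
  set ω : (ι →₀ ℕ) → ℕ := fun u =>
    ∏ k, boxWeight (min (x k) (y k)) (max (x k) (y k)) d (u k) with hω
  set F := wt (fun u => (ω u : R)) f with hF
  have hFc : ∀ u, coeff u F = ω u * coeff u f := fun u => by rw [hF, coeff_wt]; rfl
  have hFd : F.IsHomogeneous d := isHomogeneous_wt _ hd
  have hωx : 0 < ω x := Finset.prod_pos fun k _ =>
    boxWeight_pos d (min_le_left _ _) (le_max_left _ _)
  have hωy : 0 < ω y := Finset.prod_pos fun k _ =>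
    boxWeight_pos d (min_le_right _ _) (le_max_right _ _)
  have hωx' : (1 : R) ≤ ω x := Nat.one_le_cast.2 hωx
  have hωy' : (1 : R) ≤ ω y := Nat.one_le_cast.2 hωy
  have hxF : x ∈ F.support := by
    rw [mem_support_iff, hFc]
    exact mul_ne_zero (by linarith) (mem_support_iff.1 hx)
  have hyF : y ∈ F.support := by
    rw [mem_support_iff, hFc]
    exact mul_ne_zero (by linarith) (mem_support_iff.1 hy)
  have hstab : S.Stable (map (algebraMap R K) F) := by
    have e : map (algebraMap R K) F = wt (fun u => (ω u : R)) (map (algebraMap R K) f) := by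
      ext u; rw [coeff_map, hFc, coeff_wt, coeff_map, map_mul]
    rcases (S.reduct_wt_box (hd.map (algebraMap R K)) (.inr hf) (fun k => min (x k) (y k))
      (fun k => max (x k) (y k)) Finset.univ).1 with h | h
    · exfalso
      rw [mem_support_iff] at hxF
      refine hxF ((algebraMap R K).injective ?_)
      rw [← coeff_map, e, map_zero]
      exact congr_arg (coeff x) h
    · rw [e]; exact h
  have hbox : ∀ u ∈ F.support, ∀ k, min (x k) (y k) ≤ u k ∧ u k ≤ max (x k) (y k) := by
    intro u hu k
    have hu' := le_of_mem_support hFd hu k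
    rw [mem_support_iff, hFc] at hu
    have h1 : ω u ≠ 0 := by
      intro h; rw [h] at hu; simp at hu
    have h2 := Finset.prod_ne_zero_iff.1 h1 k (Finset.mem_univ k)
    constructor
    · by_contra! h; exact h2 (boxWeight_eq_zero_of_lt h)
    · by_contra! h; exact h2 (boxWeight_eq_zero_of_gt h hu')
  have hFnn : ∀ u, 0 ≤ coeff u F := fun u => by
    rw [hFc]; exact mul_nonneg (Nat.cast_nonneg _) (hnn u)
  obtain ⟨j, hj, c, hc⟩ := S.exchange_of_box hFd hstab hFnn hxF hyF hbox hi
  refine ⟨j, hj, c * (ω (x - Finsupp.single i 1 + Finsupp.single j 1) *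
    ω (y + Finsupp.single i 1 - Finsupp.single j 1)), ?_⟩
  have h1 : coeff x f ≤ coeff x F := by
    rw [hFc]; exact le_mul_of_one_le_left (hnn x) hωx'
  have h2 : coeff y f ≤ coeff y F := by
    rw [hFc]; exact le_mul_of_one_le_left (hnn y) hωy'
  refine (mul_le_mul h1 h2 (hnn y) (hFnn x)).trans (hc.trans (le_of_eq ?_))
  rw [hFc, hFc]; push_cast; ring

end CartesianCoords

section

/-! ### M-convex sets from the exchange property -/

theorem left_mem_extremePoints_segment {E : Type*} [AddCommGroup E] [Module ℝ E] {a b : E}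
    (hab : a ≠ b) : a ∈ Set.extremePoints ℝ (segment ℝ a b) := by
  rw [mem_extremePoints_iff_left]
  refine ⟨left_mem_segment ℝ a b, fun p hp q hq h => ?_⟩
  rw [segment_eq_image'] at hp hq
  obtain ⟨s, hs, rfl⟩ := hp
  obtain ⟨t, ht, rfl⟩ := hq
  obtain ⟨α, β, hα, hβ, h1, h2⟩ := h
  have h3 : (α * s + β * t) • (b - a) = 0 := by
    have e : α • (a + s • (b - a)) + β • (a + t • (b - a)) =
        (α + β) • a + (α * s + β * t) • (b - a) := by module
    rw [e, h1, one_smul] at h2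
    simpa using h2
  have h4 := (smul_eq_zero.1 h3).resolve_right (sub_ne_zero.2 hab.symm)
  have h5 : s = 0 := by
    have := mul_nonneg hα.le hs.1
    have := mul_nonneg hβ.le ht.1
    exact (mul_eq_zero.1 (by linarith : α * s = 0)).resolve_left hα.ne'
  simp [h5]

theorem right_mem_extremePoints_segment {E : Type*} [AddCommGroup E] [Module ℝ E] {a b : E}
    (hab : a ≠ b) : b ∈ Set.extremePoints ℝ (segment ℝ a b) := by
  rw [segment_symm]; exact left_mem_extremePoints_segment hab.symm

theorem toReal_add {n : ℕ} (x y : Fin n → ℤ) : toReal (x + y) = toReal x + toReal y := by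
  ext k; simp [toReal]

theorem toReal_sub {n : ℕ} (x y : Fin n → ℤ) : toReal (x - y) = toReal x - toReal y := by
  ext k; simp [toReal]

theorem toReal_single {n : ℕ} (i : Fin n) :
    toReal (Pi.single i (1 : ℤ)) = Pi.single i (1 : ℝ) := by
  ext k; simp [toReal, Pi.single_apply]

/-- The simultaneous exchange property. -/
def Exchange {n : ℕ} (S : Set (Fin n → ℤ)) : Prop :=
  ∀ x ∈ S, ∀ y ∈ S, ∀ i, y i < x i → ∃ j, x j < y j ∧
    x - Pi.single i 1 + Pi.single j 1 ∈ S ∧ y + Pi.single i 1 - Pi.single j 1 ∈ S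

variable {n : ℕ} {S : Set (Fin n → ℤ)}

/-- The endpoints of an edge belong to S. The exchanged points have the same sum, so both still
maximize the exposing functional; hence x − e_i + e_j lies on the edge and determines its direction.
-/
theorem Exchange.edge (hS : Exchange S) {a b : Fin n → ℝ} (hab : a ≠ b)
    (h : IsExposed ℝ (convexHull ℝ (toReal '' S)) (segment ℝ a b)) :
    ∃ (i j : Fin n) (c : ℝ), b - a = c • (Pi.single i (1 : ℝ) - Pi.single j (1 : ℝ)) := by
  have hext := h.isExtreme.extremePoints_subset_extremePoints
  obtain ⟨x, hx, rfl⟩ :=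
    extremePoints_convexHull_subset (hext (left_mem_extremePoints_segment hab))
  obtain ⟨y, hy, rfl⟩ :=
    extremePoints_convexHull_subset (hext (right_mem_extremePoints_segment hab))
  obtain ⟨l, hl⟩ := h ⟨_, left_mem_segment ℝ _ _⟩
  have hmem : ∀ z ∈ S, toReal z ∈ convexHull ℝ (toReal '' S) := fun z hz =>
    subset_convexHull ℝ _ ⟨z, hz, rfl⟩
  obtain ⟨i, j, hi, hj, h1, h2⟩ : ∃ i j, y i < x i ∧ x j < y j ∧
      x - Pi.single i 1 + Pi.single j 1 ∈ S ∧ y + Pi.single i 1 - Pi.single j 1 ∈ S := by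
    obtain ⟨k, hk⟩ := Function.ne_iff.1 fun h : x = y => hab (by rw [h])
    rcases lt_or_gt_of_ne hk with hk | hk
    · obtain ⟨j, hj, h1, h2⟩ := hS y hy x hx k hk
      exact ⟨j, k, hj, hk, by rwa [sub_add_eq_add_sub], by rwa [add_sub_right_comm]⟩
    · obtain ⟨j, hj, h1, h2⟩ := hS x hx y hy k hk
      exact ⟨k, j, hk, hj, h1, h2⟩
  have hij : i ≠ j := by rintro rfl; omega
  have hxm : ∀ z ∈ convexHull ℝ (toReal '' S), l z ≤ l (toReal x) :=
    (hl ▸ left_mem_segment ℝ (toReal x) (toReal y)).2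
  have hym : ∀ z ∈ convexHull ℝ (toReal '' S), l z ≤ l (toReal y) :=
    (hl ▸ right_mem_segment ℝ (toReal x) (toReal y)).2
  have e1 := hym _ (hmem _ h2)
  have hp : toReal (x - Pi.single i 1 + Pi.single j 1) ∈ segment ℝ (toReal x) (toReal y) := by
    rw [hl]
    refine ⟨hmem _ h1, fun z hz => (hxm z hz).trans ?_⟩
    simp only [toReal_add, toReal_sub, toReal_single, map_add, map_sub] at e1 ⊢
    linarith
  rw [segment_eq_image'] at hp
  obtain ⟨t, -, ht⟩ := hp
  have ht' : t • (toReal y - toReal x) = Pi.single j (1 : ℝ) - Pi.single i (1 : ℝ) := by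
    simp only [toReal_add, toReal_sub, toReal_single] at ht
    rw [← add_right_inj (toReal x), ht]; abel
  have ht0 : t ≠ 0 := by
    rintro rfl
    have := congr_fun ht' j
    simp [hij.symm] at this
  exact ⟨j, i, t⁻¹, by rw [← ht', smul_smul, inv_mul_cancel₀ ht0, one_smul]⟩

/-- The squared Euclidean norm of a lattice point. -/
def sqNorm (x : Fin n → ℤ) : ℤ := ∑ k, x k ^ 2

theorem sum_single_sub_mul (i j : Fin n) (c : Fin n → ℤ) :
    ∑ k, ((Pi.single i 1 : Fin n → ℤ) k - (Pi.single j 1 : Fin n → ℤ) k) * c k = c i - c j := by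
  simp [sub_mul, Finset.sum_sub_distrib, Pi.single_apply]

theorem sqNorm_add_single_sub_single (x : Fin n → ℤ) {i j : Fin n} (hij : i ≠ j) :
    sqNorm (x + Pi.single i 1 - Pi.single j 1) = sqNorm x + 2 * (x i - x j) + 2 := by
  have h := sum_single_sub_mul i j
    (fun k => 2 * x k + (Pi.single i 1 : Fin n → ℤ) k - (Pi.single j 1 : Fin n → ℤ) k)
  have e : sqNorm (x + Pi.single i 1 - Pi.single j 1) = sqNorm x +
      ∑ k, ((Pi.single i 1 : Fin n → ℤ) k - (Pi.single j 1 : Fin n → ℤ) k) *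
        (2 * x k + (Pi.single i 1 : Fin n → ℤ) k - (Pi.single j 1 : Fin n → ℤ) k) := by
    rw [sqNorm, sqNorm, ← Finset.sum_add_distrib]
    refine Finset.sum_congr rfl fun k _ => ?_
    simp only [Pi.add_apply, Pi.sub_apply]; ring
  rw [e, h]
  simp only [Pi.single_eq_same, Pi.single_eq_of_ne hij, Pi.single_eq_of_ne hij.symm]
  ring

/-- `w` are the coefficients of a convex combination of the points of `S` representing `x`. -/
def IsCombination [Fintype S] (x : Fin n → ℝ) (w : S → ℝ) : Prop :=
  (∀ s, 0 ≤ w s) ∧ ∑ s, w s = 1 ∧ ∀ k, ∑ s, w s * ((s : Fin n → ℤ) k : ℝ) = x k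

theorem exists_isCombination [Fintype S] {x : Fin n → ℝ}
    (hx : x ∈ convexHull ℝ (toReal '' S)) : ∃ w : S → ℝ, IsCombination x w := by
  classical
  refine convexHull_min (t := {x | ∃ w : S → ℝ, IsCombination x w}) ?_ ?_ hx
  · rintro _ ⟨s, hs, rfl⟩
    refine ⟨Pi.single ⟨s, hs⟩ 1, fun t => ?_, by simp, fun k => ?_⟩
    · by_cases h : t = ⟨s, hs⟩
      · subst h; simp
      · simp [h]
    · rw [Finset.sum_eq_single ⟨s, hs⟩]
      · simp [toReal]
      · intro t _ ht; simp [ht]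
      · simp
  · rintro x ⟨w, h1, h2, h3⟩ y ⟨w', h1', h2', h3'⟩ α β hα hβ hαβ
    refine ⟨fun s => α * w s + β * w' s, fun s => ?_, ?_, fun k => ?_⟩
    · have := h1 s; have := h1' s; positivity
    · rw [Finset.sum_add_distrib, ← Finset.mul_sum, ← Finset.mul_sum, h2, h2']; linarith
    · simp only [add_mul, mul_assoc, Finset.sum_add_distrib, ← Finset.mul_sum, h3, h3']
      simp

theorem isCompact_isCombination [Fintype S] (x : Fin n → ℝ) :
    IsCompact {w : S → ℝ | IsCombination x w} := by
  refine (isCompact_stdSimplex ℝ S).of_isClosed_subset ?_ fun w hw => ⟨hw.1, hw.2.1⟩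
  have e : {w : S → ℝ | IsCombination x w} = stdSimplex ℝ S ∩
      ⋂ k, {w : S → ℝ | ∑ s, w s * ((s : Fin n → ℤ) k : ℝ) = x k} := by
    ext w
    simp only [IsCombination, stdSimplex, Set.mem_ofPred_eq, Set.mem_inter_iff, Set.mem_iInter,
      and_assoc]
  rw [e]
  exact (isClosed_stdSimplex ℝ S).inter (isClosed_iInter fun k =>
    isClosed_eq (by fun_prop) continuous_const)

/-- Among the representations of x as a convex combination of S, take one minimizing Σ w_s |s|². If
x ∉ S, two points a, b of positive weight satisfy b_i < x_i < a_i for some i; moving weight from a,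
b to their exchanged pair keeps the barycentre and lowers the sum. -/
theorem Exchange.mem_of_toReal_mem (hS : Exchange S) (hfin : S.Finite) {x : Fin n → ℤ}
    (hx : toReal x ∈ convexHull ℝ (toReal '' S)) : x ∈ S := by
  classical
  have : Fintype S := hfin.fintype
  obtain ⟨w, ⟨hw0, hw1, hwx⟩, hmin⟩ := (isCompact_isCombination (S := S) (toReal x)).exists_isMinOn
    (exists_isCombination hx) (f := fun w : S → ℝ => ∑ s, w s * ((sqNorm (s : Fin n → ℤ) : ℤ) : ℝ))
    (by fun_prop : Continuous _).continuousOn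
  by_contra hxS
  have hw1' : ∃ s, 0 < w s := by
    by_contra! hcon
    have := Finset.sum_nonpos fun s (_ : s ∈ (Finset.univ : Finset S)) => hcon s
    linarith
  obtain ⟨s, hs⟩ := hw1'
  obtain ⟨i, hi⟩ := Function.ne_iff.1 fun h : (s : Fin n → ℤ) = x => hxS (h ▸ s.2)
  have hsum : ∑ t, w t * (((t : Fin n → ℤ) i : ℝ) - x i) = 0 := by
    have := hwx i
    simp only [mul_sub, Finset.sum_sub_distrib, ← Finset.sum_mul, hw1, this]
    simp [toReal]
  have hsne : w s * (((s : Fin n → ℤ) i : ℝ) - x i) ≠ 0 :=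
    mul_ne_zero hs.ne' (sub_ne_zero.2 (by exact_mod_cast hi))
  obtain ⟨a, -, ha⟩ := Finset.exists_pos_of_sum_zero_of_exists_nonzero _ hsum
    ⟨s, Finset.mem_univ s, hsne⟩
  obtain ⟨b, -, hb⟩ := Finset.exists_pos_of_sum_zero_of_exists_nonzero
    (fun t : S => -(w t * (((t : Fin n → ℤ) i : ℝ) - x i)))
    (by rw [Finset.sum_neg_distrib, hsum, neg_zero]) ⟨s, Finset.mem_univ s, neg_ne_zero.2 hsne⟩
  have hwa : 0 < w a := lt_of_le_of_ne (hw0 a) fun h => by rw [← h] at ha; simp at ha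
  have hwb : 0 < w b := lt_of_le_of_ne (hw0 b) fun h => by rw [← h] at hb; simp at hb
  have hai : x i < (a : Fin n → ℤ) i := by
    have := (mul_pos_iff_of_pos_left hwa).1 ha
    exact_mod_cast sub_pos.1 this
  have hbi : (b : Fin n → ℤ) i < x i := by
    rw [← mul_neg, neg_sub] at hb
    have := (mul_pos_iff_of_pos_left hwb).1 hb
    exact_mod_cast sub_pos.1 this
  obtain ⟨j, hj, hp, hq⟩ := hS a a.2 b b.2 i (by omega)
  have hij : i ≠ j := by rintro rfl; omega
  set p : S := ⟨_, hp⟩ with hpdef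
  set q : S := ⟨_, hq⟩ with hqdef
  have hab : a ≠ b := by rintro rfl; omega
  -- The largest weight that can be taken from both a and b; p and q only gain weight, so possible
  -- coincidences with them do no harm.
  set ε := min (w a) (w b)
  have hε : 0 < ε := lt_min hwa hwb
  set w' : S → ℝ := fun t => w t + ε * ((Pi.single p 1 : S → ℝ) t + (Pi.single q 1 : S → ℝ) t -
    (Pi.single a 1 : S → ℝ) t - (Pi.single b 1 : S → ℝ) t) with hw'
  have hlin : ∀ g : S → ℝ, ∑ t, w' t * g t = ∑ t, w t * g t + ε * (g p + g q - g a - g b) := by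
    intro g
    have e : ∀ t, w' t * g t = w t * g t + ε * ((Pi.single p 1 : S → ℝ) t * g t +
        (Pi.single q 1 : S → ℝ) t * g t - (Pi.single a 1 : S → ℝ) t * g t -
        (Pi.single b 1 : S → ℝ) t * g t) := fun t => by simp only [hw']; ring
    simp only [e, Finset.sum_add_distrib, ← Finset.mul_sum, Finset.sum_sub_distrib]
    simp [Pi.single_apply]
  have hcomb : IsCombination (toReal x) w' := by
    refine ⟨fun t => ?_, ?_, fun k => ?_⟩
    · have h1 : 0 ≤ (Pi.single p 1 : S → ℝ) t := by
        rw [Pi.single_apply]; split_ifs <;> norm_num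
      have h2 : 0 ≤ (Pi.single q 1 : S → ℝ) t := by
        rw [Pi.single_apply]; split_ifs <;> norm_num
      have h3 : ε * ((Pi.single a 1 : S → ℝ) t + (Pi.single b 1 : S → ℝ) t) ≤ w t := by
        rcases eq_or_ne t a with rfl | hta
        · simp [Pi.single_eq_of_ne hab, ε]
        · rcases eq_or_ne t b with rfl | htb
          · simp [Pi.single_eq_of_ne hab.symm, ε]
          · simp [Pi.single_eq_of_ne hta, Pi.single_eq_of_ne htb, hw0 t]
      have h4 : 0 ≤ ε * ((Pi.single p 1 : S → ℝ) t + (Pi.single q 1 : S → ℝ) t) :=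
        mul_nonneg hε.le (add_nonneg h1 h2)
      simp only [hw']
      linarith
    · have := hlin fun _ => 1
      simp only [mul_one, hw1] at this
      rw [this]; ring
    · rw [hlin fun t => ((t : Fin n → ℤ) k : ℝ), hwx k]
      simp only [hpdef, hqdef, Pi.add_apply, Pi.sub_apply]
      push_cast
      ring
  have hle : ∑ t, w t * ((sqNorm (t : Fin n → ℤ) : ℤ) : ℝ) ≤
      ∑ t, w' t * ((sqNorm (t : Fin n → ℤ) : ℤ) : ℝ) := hmin hcomb
  rw [hlin fun t => ((sqNorm (t : Fin n → ℤ) : ℤ) : ℝ)] at hle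
  have hneg : sqNorm (p : Fin n → ℤ) + sqNorm (q : Fin n → ℤ) - sqNorm (a : Fin n → ℤ) -
      sqNorm (b : Fin n → ℤ) < 0 := by
    have e1 : (p : Fin n → ℤ) = (a : Fin n → ℤ) + Pi.single j 1 - Pi.single i 1 := by
      simp only [hpdef]; abel
    rw [e1, hqdef, sqNorm_add_single_sub_single _ hij, sqNorm_add_single_sub_single _ hij.symm]
    -- Since x_i is an integer strictly between b_i and a_i, a_i − b_i ≥ 2; with b_j − a_j ≥ 1 the
    -- change is at most −2. A gap of 1 at i would not give a strict decrease.
    omega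
  have hneg' : ((sqNorm (p : Fin n → ℤ) : ℤ) : ℝ) + (sqNorm (q : Fin n → ℤ) : ℤ) -
      (sqNorm (a : Fin n → ℤ) : ℤ) - (sqNorm (b : Fin n → ℤ) : ℤ) < 0 := by exact_mod_cast hneg
  have := mul_neg_of_pos_of_neg hε hneg'
  linarith

theorem Exchange.isMConvexSet (hS : Exchange S) (hfin : S.Finite) (hne : S.Nonempty) :
    IsMConvexSet S := by
  refine ⟨convexHull ℝ (toReal '' S), ⟨⟨hfin.toFinset, ?_, ?_⟩, fun a b hab h => hS.edge hab h⟩, ?_⟩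
  · simpa using hne
  · simp
  · ext x
    exact ⟨fun hx => subset_convexHull ℝ _ ⟨x, hx, rfl⟩, fun hx => hS.mem_of_toReal_mem hfin hx⟩

end

/-! ### The exchange inequality for valuations -/

theorem map_natCast_nonneg {K : Type*} [Field K] (v : AddValuation K (WithTop ℝ)) (m : ℕ) :
    0 ≤ v (m : K) := by
  induction m with
  | zero => simp
  | succ m ih =>
    rw [Nat.cast_succ]
    exact (le_min ih v.map_one.ge).trans (v.map_add _ _)

/-- The hypotheses make x_i and y_j positive, so the truncated subtractions are exact. -/
theorem add_eq_add_cast {ι : Type*} [DecidableEq ι] {x y : ι →₀ ℕ} {i j : ι} (hi : y i < x i)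
    (hj : x j < y j) :
    (fun k => (((x - Finsupp.single i 1 + Finsupp.single j 1 : ι →₀ ℕ) k : ℕ) : ℤ)) =
      (fun k => (x k : ℤ)) - Pi.single i 1 + Pi.single j 1 ∧
    (fun k => (((y + Finsupp.single i 1 - Finsupp.single j 1 : ι →₀ ℕ) k : ℕ) : ℤ)) =
      (fun k => (y k : ℤ)) + Pi.single i 1 - Pi.single j 1 := by
  constructor
  · funext k
    simp only [Finsupp.add_apply, Finsupp.tsub_apply, Finsupp.single_apply, Pi.add_apply,
      Pi.sub_apply, Pi.single_apply]
    by_cases h1 : k = i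
    · subst h1
      obtain ⟨m, hm⟩ := Nat.exists_eq_succ_of_ne_zero (Nat.ne_zero_of_lt hi)
      have hkj : k ≠ j := by rintro rfl; omega
      rw [if_neg hkj, if_neg hkj.symm, hm]
      simp
    · rw [if_neg (Ne.symm h1), if_neg h1]
      by_cases h2 : k = j
      · subst h2; simp
      · rw [if_neg (Ne.symm h2), if_neg h2]; simp
  · funext k
    simp only [Finsupp.add_apply, Finsupp.tsub_apply, Finsupp.single_apply, Pi.add_apply,
      Pi.sub_apply, Pi.single_apply]
    by_cases h2 : k = j
    · subst h2
      obtain ⟨m, hm⟩ := Nat.exists_eq_succ_of_ne_zero (Nat.ne_zero_of_lt hj)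
      have hki : k ≠ i := by rintro rfl; omega
      rw [if_neg hki, if_neg hki.symm, hm]
      simp
    · rw [if_neg (Ne.symm h2), if_neg h2]
      by_cases h1 : k = i
      · subst h1; simp
      · rw [if_neg (Ne.symm h1), if_neg h1]; simp

section Exchange

variable {R K : Type*} [Field R] [LinearOrder R] [IsStrictOrderedRing R] [IsRealClosed R]
  [Field K] [Algebra R K] (S : CartesianCoords R K)
  (v : AddValuation K (WithTop ℝ))
  (hv : ∀ a b : R, 0 ≤ a → a ≤ b → v (algebraMap R K b) ≤ v (algebraMap R K a))
  {n : ℕ} {f : MvPolynomial (Fin n) K} {d : ℕ} (hd : f.IsHomogeneous d) (hf : S.Stable f)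

include hd hf in
/-- Up to a scalar, `f` has nonnegative coefficients in `R`. -/
theorem CartesianCoords.exists_real_form : ∃ (a : K) (F : MvPolynomial (Fin n) R), a ≠ 0 ∧
    F.IsHomogeneous d ∧ S.Stable (map (algebraMap R K) F) ∧ (∀ u, 0 ≤ coeff u F) ∧
    ∀ u, coeff u f = algebraMap R K (coeff u F) * a := by
  have := S.isAlgClosed
  have ha := S.eval_one_ne_zero hd hf
  choose r hr hr' using S.coeff_eq_mul_eval_one hd hf
  have hF : ∀ u, coeff u (∑ u ∈ f.support, monomial u (r u)) = r u := by
    intro u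
    classical
    simp only [coeff_sum, coeff_monomial, Finset.sum_ite_eq']
    split_ifs with h
    · rfl
    · have h1 := hr' u
      rw [notMem_support_iff.1 h] at h1
      have h2 := (mul_eq_zero.1 h1.symm).resolve_right ha
      exact ((map_eq_zero _).1 h2).symm
  refine ⟨eval 1 f, ∑ u ∈ f.support, monomial u (r u), ha, fun u hu => ?_, fun z hz h0 => ?_,
    fun u => by rw [hF]; exact hr u, fun u => by rw [hF]; exact hr' u⟩
  · refine hd ?_
    rw [hr']
    rw [hF] at hu
    exact mul_ne_zero (by rwa [Ne, map_eq_zero]) ha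
  · refine hf z hz ?_
    have e : f = map (algebraMap R K) (∑ u ∈ f.support, monomial u (r u)) * C (eval 1 f) := by
      ext u
      rw [mul_comm, coeff_C_mul, coeff_map, hF, hr', mul_comm]
    rw [e, map_mul, h0, zero_mul]

include S hv hd hf in
theorem val_exchange {x y : Fin n →₀ ℕ} (hx : x ∈ f.support) (hy : y ∈ f.support) {i : Fin n}
    (hi : y i < x i) : ∃ j, x j < y j ∧
      x - Finsupp.single i 1 + Finsupp.single j 1 ∈ f.support ∧
      y + Finsupp.single i 1 - Finsupp.single j 1 ∈ f.support ∧
      val v (coeff (x - Finsupp.single i 1 + Finsupp.single j 1) f) +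
        val v (coeff (y + Finsupp.single i 1 - Finsupp.single j 1) f) ≤
      val v (coeff x f) + val v (coeff y f) := by
  have := S.isAlgClosed
  obtain ⟨a, F, ha, hFd, hFs, hFnn, hfF⟩ := S.exists_real_form hd hf
  have hsupp : ∀ u, u ∈ f.support ↔ u ∈ F.support := fun u => by
    rw [mem_support_iff, mem_support_iff, hfF, Ne, mul_eq_zero, not_or, map_eq_zero]
    exact and_iff_left ha
  have hx' := (hsupp x).1 hx
  have hy' := (hsupp y).1 hy
  obtain ⟨j, hj, c, hc⟩ := S.exchange hFd hFs hFnn hx' hy' hi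
  set p := x - Finsupp.single i 1 + Finsupp.single j 1
  set q := y + Finsupp.single i 1 - Finsupp.single j 1
  have hxy : 0 < coeff x F * coeff y F :=
    mul_pos (lt_of_le_of_ne (hFnn x) (mem_support_iff.1 hx').symm)
      (lt_of_le_of_ne (hFnn y) (mem_support_iff.1 hy').symm)
  -- The left side of the exchange inequality is positive, so neither exchanged coefficient vanishes
  -- and both points lie in the support.
  have hpq : coeff p F * coeff q F ≠ 0 := fun h => by
    rw [h, mul_zero] at hc; linarith
  have hp := (hsupp p).2 (mem_support_iff.2 (left_ne_zero_of_mul hpq))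
  have hq := (hsupp q).2 (mem_support_iff.2 (right_ne_zero_of_mul hpq))
  refine ⟨j, hj, hp, hq, ?_⟩
  -- Compatibility reverses the inequality. The natural number c has nonnegative valuation and is
  -- dropped; the common scalar a adds 2 v(a) to both sides.
  have h1 := hv _ _ hxy.le hc
  simp only [map_mul, v.map_mul, map_natCast] at h1
  have h2 : v (coeff p f) + v (coeff q f) ≤ v (coeff x f) + v (coeff y f) := by
    simp only [hfF, v.map_mul]
    have h3 : v (algebraMap R K (coeff p F)) + v (algebraMap R K (coeff q F)) ≤
        v (algebraMap R K (coeff x F)) + v (algebraMap R K (coeff y F)) :=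
      (le_add_of_nonneg_left (map_natCast_nonneg v c)).trans h1
    calc _ = v (algebraMap R K (coeff p F)) + v (algebraMap R K (coeff q F)) + (v a + v a) := by
          abel
      _ ≤ v (algebraMap R K (coeff x F)) + v (algebraMap R K (coeff y F)) + (v a + v a) := by
          gcongr
      _ = _ := by abel
  rw [← coe_val v (mem_support_iff.1 hx), ← coe_val v (mem_support_iff.1 hy),
    ← coe_val v (mem_support_iff.1 hp), ← coe_val v (mem_support_iff.1 hq)] at h2
  exact_mod_cast h2

end Exchange

/-! ### Minimizers of the weight -/

theorem latticeCoeff_cast {n : ℕ} {A : Type*} [CommSemiring A] (f : MvPolynomial (Fin n) A)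
    (u : Fin n →₀ ℕ) : latticeCoeff f (fun k => (u k : ℤ)) = coeff u f := by
  rw [latticeCoeff]
  congr 1
  ext k
  simp

theorem finite_latticeSupport {n : ℕ} {A : Type*} [CommSemiring A] (f : MvPolynomial (Fin n) A) :
    (latticeSupport f).Finite := by
  refine (f.support.finite_toSet.image fun u k => ((u k : ℕ) : ℤ)).subset ?_
  rintro x ⟨u, hu, rfl⟩
  exact ⟨u, hu, rfl⟩

/-- The linear term has equal sums over x, y and over the exchanged pair. If x and y are both
minimizers, the exchanged weights sum to at most twice the minimum, so both exchanged points are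
minimizers. -/
theorem isMConvexFun_of_exchange {K : Type*} [Field K] (v : AddValuation K (WithTop ℝ)) {n : ℕ}
    {f : MvPolynomial (Fin n) K} (hf0 : f ≠ 0)
    (h : ∀ x ∈ f.support, ∀ y ∈ f.support, ∀ i, y i < x i → ∃ j, x j < y j ∧
      x - Finsupp.single i 1 + Finsupp.single j 1 ∈ f.support ∧
      y + Finsupp.single i 1 - Finsupp.single j 1 ∈ f.support ∧
      val v (coeff (x - Finsupp.single i 1 + Finsupp.single j 1) f) +
        val v (coeff (y + Finsupp.single i 1 - Finsupp.single j 1) f) ≤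
      val v (coeff x f) + val v (coeff y f)) :
    IsMConvexFun (latticeSupport f) fun x => val v (latticeCoeff f x) := by
  intro w
  refine Exchange.isMConvexSet ?_ ((finite_latticeSupport f).subset fun x hx => hx.1) ?_
  · rintro _ ⟨⟨x, hx, rfl⟩, hxmin⟩ _ ⟨⟨y, hy, rfl⟩, hymin⟩ i hi
    have hi' : y i < x i := Int.ofNat_lt.1 hi
    obtain ⟨j, hj, hp, hq, hle⟩ := h x hx y hy i hi'
    obtain ⟨e1, e2⟩ := add_eq_add_cast hi' hj
    have hpL : (fun k => ((x k : ℕ) : ℤ)) - Pi.single i 1 + Pi.single j 1 ∈ latticeSupport f :=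
      ⟨_, hp, e1.symm⟩
    have hqL : (fun k => ((y k : ℕ) : ℤ)) + Pi.single i 1 - Pi.single j 1 ∈ latticeSupport f :=
      ⟨_, hq, e2.symm⟩
    have hsum : ∀ (a b : Fin n → ℤ),
        ∑ k, w k * (((a - Pi.single i 1 + Pi.single j 1 : Fin n → ℤ) k : ℤ) : ℝ) +
        ∑ k, w k * (((b + Pi.single i 1 - Pi.single j 1 : Fin n → ℤ) k : ℤ) : ℝ) =
        ∑ k, w k * (a k : ℝ) + ∑ k, w k * (b k : ℝ) := by
      intro a b
      rw [← Finset.sum_add_distrib, ← Finset.sum_add_distrib]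
      refine Finset.sum_congr rfl fun k _ => ?_
      simp only [Pi.add_apply, Pi.sub_apply]
      push_cast; ring
    have hs := hsum (fun k => (x k : ℤ)) fun k => (y k : ℤ)
    have m1 := hxmin _ hpL
    have m2 := hymin _ hqL
    have m3 := hxmin _ ⟨y, hy, rfl⟩
    have m4 := hymin _ ⟨x, hx, rfl⟩
    rw [← latticeCoeff_cast f x, ← latticeCoeff_cast f y, ← latticeCoeff_cast, e1,
      ← latticeCoeff_cast, e2] at hle
    refine ⟨j, Int.ofNat_lt.2 hj, ⟨hpL, fun z hz => (le_trans ?_ (hxmin z hz))⟩,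
      ⟨hqL, fun z hz => (le_trans ?_ (hymin z hz))⟩⟩
    · simp only [Int.cast_natCast] at m1 m2 m3 m4 hs ⊢
      linarith
    · simp only [Int.cast_natCast] at m1 m2 m3 m4 hs ⊢
      linarith
  · obtain ⟨u, hu⟩ := support_nonempty.2 hf0
    obtain ⟨x, hx, hmin⟩ := Set.exists_min_image (latticeSupport f)
      (fun x => val v (latticeCoeff f x) + ∑ k, w k * (x k : ℝ)) (finite_latticeSupport f)
      ⟨_, u, hu, rfl⟩
    exact ⟨x, hx, hmin⟩

/-! ### Initial forms -/

/-- Both c/t and t/c have valuation 0, so c/t is a unit of the valuation ring. Hence reduction loses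
no minimizing term of the initial form. -/
theorem reduce_ne_zero {K : Type*} [Field K] (v : AddValuation K (WithTop ℝ)) {c t : K}
    (hc : c ≠ 0) (ht : v t = v c) : reduce v (c / t) ≠ 0 := by
  have hvc : v c ≠ ⊤ := (AddValuation.ne_top_iff v).2 hc
  have ht0 : t ≠ 0 := (AddValuation.ne_top_iff v).1 (by rwa [ht])
  have key : ∀ a b : K, b ≠ 0 → v a = v b → a / b ∈ valRing v := by
    intro a b hb hab
    rw [mem_valRing_iff]
    have hvb : v b ≠ ⊤ := (AddValuation.ne_top_iff v).2 hb
    have h1 : v (a / b) + v b = 0 + v b := by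
      rw [← v.map_mul, div_mul_cancel₀ _ hb, hab, zero_add]
    exact (WithTop.add_right_cancel hvb h1).ge
  have hmem := key c t ht0 ht.symm
  rw [reduce, dif_pos hmem, IsLocalRing.residue_ne_zero_iff_isUnit]
  exact IsUnit.of_mul_eq_one ⟨t / c, key t c hc ht⟩ (Subtype.ext (by
    change c / t * (t / c) = 1
    field_simp))

theorem latticeSupport_tInit {K : Type*} [Field K] (v : AddValuation K (WithTop ℝ)) {t : ℝ → K}
    (ht : IsPowerChoice v t) {n : ℕ} (w : Fin n → ℝ) (f : MvPolynomial (Fin n) K) :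
    latticeSupport (tInit v t w f) = {x | x ∈ latticeSupport f ∧ ∀ y ∈ latticeSupport f,
      val v (latticeCoeff f x) + ∑ k, w k * (x k : ℝ) ≤
        val v (latticeCoeff f y) + ∑ k, w k * (y k : ℝ)} := by
  classical
  have hsupp : ∀ u, u ∈ (tInit v t w f).support ↔
      u ∈ f.support ∧ ∀ u' ∈ f.support, weight v w f u ≤ weight v w f u' := by
    intro u
    rw [mem_support_iff, tInit]
    simp only [coeff_sum, coeff_monomial, Finset.sum_ite_eq', Finset.mem_filter]
    split_ifs with h
    · exact iff_of_true (reduce_ne_zero v (mem_support_iff.1 h.1)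
        (ht _ (mem_support_iff.1 h.1))) h
    · exact iff_of_false (fun h => h rfl) h
  have hw : ∀ u, weight v w f u = val v (latticeCoeff f fun k => (u k : ℤ)) +
      ∑ k, w k * (((u k : ℕ) : ℤ) : ℝ) := fun u => by
    simp only [weight, latticeCoeff_cast, Int.cast_natCast]
  ext x
  constructor
  · rintro ⟨u, hu, rfl⟩
    obtain ⟨h1, h2⟩ := (hsupp u).1 hu
    refine ⟨⟨u, h1, rfl⟩, ?_⟩
    rintro _ ⟨u', hu', rfl⟩
    rw [← hw, ← hw]
    exact h2 u' hu'
  · rintro ⟨⟨u, hu, rfl⟩, hmin⟩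
    refine ⟨u, (hsupp u).2 ⟨hu, fun u' hu' => ?_⟩, rfl⟩
    rw [hw, hw]
    exact hmin _ ⟨u', hu', rfl⟩

end MConvexStable

end

theorem mainTheorem6
    {R K : Type*} [Field R] [LinearOrder R] [IsStrictOrderedRing R] [IsRealClosed R]
    [Field K] [Algebra R K] (i : K) (hi : i ^ 2 = -1)
    (hK : IntermediateField.adjoin R {i} = ⊤)
    (v : AddValuation K (WithTop ℝ))
    (hv : ∀ a b : R, 0 ≤ a → a ≤ b → v (algebraMap R K b) ≤ v (algebraMap R K a))
    {n : ℕ} (f : MvPolynomial (Fin n) K) (d : ℕ) (hd : f.IsHomogeneous d)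
    (hf : MConvexStable.IsStable R i f) :
    MConvexStable.IsMConvexFun (MConvexStable.latticeSupport f)
        (fun x => MConvexStable.val v (MConvexStable.latticeCoeff f x)) ∧
      ∀ t : ℝ → K, MConvexStable.IsPowerChoice v t →
        ∀ w : Fin n → ℝ,
          MConvexStable.IsMConvexSet
            (MConvexStable.latticeSupport (MConvexStable.tInit v t w f)) := by
  have hi' : i * i = -1 := by rw [← pow_two, hi]
  let S := MConvexStable.CartesianCoords.ofAdjoin (R := R) i hi' hK
  have hS : S.Stable f := fun z hz h0 => by
    refine hf (fun k => S.re (z k)) (fun k => S.im (z k)) hz ?_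
    have e : (fun k => algebraMap R K (S.re (z k)) + i * algebraMap R K (S.im (z k))) = z :=
      funext fun k => S.eta (z k)
    rw [e, h0]
  have hf0 : f ≠ 0 := fun h => hf 0 1 (fun _ => one_pos) (by rw [h, map_zero])
  have hfun := MConvexStable.isMConvexFun_of_exchange v hf0 fun x hx y hy k hk =>
    MConvexStable.val_exchange S v hv hd hS hx hy hk
  exact ⟨hfun, fun t ht w => by
    rw [MConvexStable.latticeSupport_tInit v ht]
    exact hfun w⟩
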